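/- Let $d\ge 1$ and let $\mathscr T_1,\dots,\mathscr T_d$ be rooted directed trees that are leafless (every vertex has a child) and locally finite (every vertex has finitely many children), with vertex sets $V_1,\dots,V_d$. Let $V=V_1\times\cdots\times V_d$ be the vertex set of their directed Cartesian product $\mathscr T$, and let $\mathsf{root}=(\mathsf{root}_1,\dots,\mathsf{root}_d)$. For $v\in V$ let $\alpha_v\in\mathbb N^d$ be its depth, whose $j$-th coordinate is the depth of $v_j$ in $\mathscr T_j$, and let $|\alpha_v|$ be the sum of the coordinates. For $v\in V$ with $v_j\ne\mathsf{root}_j$ let $\mathsf{par}_j(v)$ be $v$ with the coordinate $v_j$ replaced by its parent. Let $\mathscr T^{\otimes}$ be the tensor product, that is, the directed graph on $V$ in which $(\mathfrak v,\mathfrak w)$ is an edge if and only if $(\mathfrak v_j,\mathfrak w_j)$ is an edge of $\mathscr T_j$ for all $j$. Let $V^{\otimes}$ be the vertex set of the connected component $\mathscr T^{\otimes}_{\mathsf{root}}$ of $\mathscr T^{\otimes}$ that contains $\mathsf{root}$; this component is a directed tree with root $\mathsf{root}$, and $\alpha_{\mathfrak v}\in\mathbb N$ denotes the depth of $\mathfrak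 v\in V^\otimes$ in it. For each $v\in V$ fix a vertex $\mathfrak v\in V^{\otimes}$ with $\alpha_{\mathfrak v}=|\alpha_v|$. The indicator function of a vertex $v$ is denoted by $e_v$. Let $S_{\boldsymbol\lambda}=(S_1,\dots,S_d)$ be a multishift on $\mathscr T$ with positive weights: the $S_j$ are bounded operators on $l^2(V)$ with $(S_jf)(v)=\lambda^{(j)}_v f(\mathsf{par}_j(v))$ if $v_j\neq\mathsf{root}_j$ and $(S_jf)(v)=0$ if $v_j=\mathsf{root}_j$. Assume that $S_{\boldsymbol\lambda}$ is joint left invertible: the $S_j$ commute, and $Q(I)$ is invertible, where $Q(X)=\sum_{j=1}^d S_j^*XS_j$. For a bounded sequence $\{c_t\}_{t\in\mathbb N}$ of positive numbers, the associated balanced weighted shift is the operator $S_\theta$ on $l^2(V^{\otimes})$ with $(S_\theta f)(\mathfrak w)=\theta_{\mathfrak w}f(\mathsf{par}(\mathfrak w))$ for $\mathfrak w\ne\mathsf{root}$ and $(S_\theta f)(\mathsf{root})=0$, where $\theta_{\mathfrak w}=\sqrt{c_{\alpha_{\mathfrak w}-1}}/\sqrt{\mathrm{card}(\mathsf{sib}(\mathfrak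 w))}$ and $\mathsf{sib}(\mathfrak w)$ is the set of children of the parent of $\mathfrak w$ in $\mathscr T^{\otimes}_{\mathsf{root}}$. A Reinhardt measure is a Borel probability measure on the unit sphere $\partial\mathbb B^d$ of $\mathbb C^d$ that is invariant under the coordinatewise action of the torus $\mathbb T^d$. For $v\in V$, complex coefficients $(a_\beta)_{\beta\in\mathbb N^d}$, $k\in\mathbb N$ and $z\in\mathbb C^d$ put $$f_k=\sum_{|\beta|\le k}a_\beta S_{\boldsymbol\lambda}^\beta e_v,\qquad f_{\theta,k}(z)=\sum_{|\beta|\le k}a_\beta z^\beta S_\theta^{|\beta|}e_{\mathfrak v}.$$ Then the following are equivalent: (i) $S_{\boldsymbol\lambda}$ is spherically balanced, i.e. $\sum_{j=1}^d\|S_je_v\|^2$ is constant on each generation $\{v\in V:|\alpha_v|=t\}$, $t\in\mathbb N$. (ii) There are a balanced weighted shift $S_\theta$, associated with some bounded sequence $\{c_t\}$ of positive numbers, and for each $v\in V$ a Reinhardt measure $\mu_v$ such that, for all $v\in V$, all coefficients $(a_\beta)$ and all $k\in\mathbb N$, $$\|f_k\|^2=\int_{\partial\mathbb B^d}\|f_{\theta,k}(z)\|^2\,d\mu_v(z).$$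 Moreover, for any $S_\theta$ and $(\mu_v)_{v\in V}$ as in (ii): (a) for all $v\in V$ and all coefficients $(a_\beta)$, if $f_k\to f$ in $l^2(V)$ as $k\to\infty$, then for $\mu_v$-almost every $z\in\partial\mathbb B^d$ the sequence $f_{\theta,k}(z)$ converges in $l^2(V^{\otimes})$ to some $f_\theta(z)$, and $\|f\|^2=\int_{\partial\mathbb B^d}\|f_\theta(z)\|^2\,d\mu_v(z)$; (b) for all $n\in\mathbb N$ and $v\in V$, $\langle Q^n(I)e_v,e_v\rangle=\|S_\theta^ne_{\mathfrak v}\|^2$ and $\|Q^n(I)\|=\|S_\theta^n\|^2$. -/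

import Mathlib

open MeasureTheory Filter Topology

noncomputable section

namespace MultishiftTree

/-! ### Directed graphs and rooted directed trees -/

section Graph

variable {V : Type*}

/-- The set of children of a set of vertices. -/
def chi (G : Digraph V) (W : Set V) : Set V := {v | ∃ u ∈ W, G.Adj u v}

/-- The `n`-fold iterated children of a set of vertices. -/
def chiN (G : Digraph V) (n : ℕ) (W : Set V) : Set V := (chi G)^[n] W

/-- A root is a vertex without (generalized) parents. -/
def IsRoot (G : Digraph V) (v : V) : Prop := ∀ u, ¬ G.Adj u v

/-- A circuit: distinct vertices `p 0, …, p (n - 1)` with `n ≥ 2`, with an edge from each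
of them to the next one and from the last one to the first one. -/
def IsCircuit (G : Digraph V) (n : ℕ) (p : ℕ → V) : Prop :=
  2 ≤ n ∧ Set.InjOn p (Set.Iio n) ∧ (∀ i, i + 1 < n → G.Adj (p i) (p (i + 1))) ∧
    G.Adj (p (n - 1)) (p 0)

/-- `u = v`, or `u` and `v` are connected by a path that ignores the orientation of edges. -/
def Linked (G : Digraph V) (u v : V) : Prop :=
  Relation.ReflTransGen (fun a b => G.Adj a b ∨ G.Adj b a) u v

/-- The depth of `v` below the vertex `r`: the number `n` for which `v` is an `n`-fold iterated
child of `r`. In a directed tree with root `r` there is exactly one such `n` for every `v`. -/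
def depthFrom (G : Digraph V) (r v : V) : ℕ := sInf {n | v ∈ chiN G n {r}}

/-- The siblings of `v` (with `v` itself): the children of the parent of `v`. -/
def sib (G : Digraph V) (v : V) : Set V := {x | ∃ u, G.Adj u v ∧ G.Adj u x}

end Graph

/-- A rooted directed tree: a directed graph without loops and circuits that is connected, has
a root, and in which every vertex other than the root has exactly one parent. -/
structure RootedDirectedTree (V : Type*) extends Digraph V where
  root : V
  loopless : ∀ v, ¬ toDigraph.Adj v v
  no_circuit : ∀ n p, ¬ IsCircuit toDigraph n p
  connected : ∀ u v, Linked toDigraph u v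
  isRoot_root : IsRoot toDigraph root
  unique_parent : ∀ v, v ≠ root → ∃! u, toDigraph.Adj u v

namespace RootedDirectedTree

variable {V : Type*} (T : RootedDirectedTree V)

/-- The depth of a vertex in a rooted directed tree. -/
def depth (v : V) : ℕ := depthFrom T.toDigraph T.root v

def LocallyFinite : Prop := ∀ u, {v | T.Adj u v}.Finite

def Leafless : Prop := ∀ u, ∃ v, T.Adj u v

end RootedDirectedTree

/-! ### Products of rooted directed trees -/

section Product

variable {d : ℕ} {V : Fin d → Type*} (T : ∀ j, RootedDirectedTree (V j))

/-- The depth `α_v ∈ ℕ^d` of a vertex of the directed Cartesian product. -/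
def depthVec (v : ∀ j, V j) : Fin d → ℕ := fun j => (T j).depth (v j)

/-- The `t`-th generation of the directed Cartesian product: the vertices with `|α_v| = t`. -/
def generation (t : ℕ) : Set (∀ j, V j) := {v | ∑ j, depthVec T v j = t}

/-- The tensor product: `(v, w)` is an edge if `(v_j, w_j)` is an edge for all `j`. -/
def tensor : Digraph (∀ j, V j) where
  Adj v w := ∀ j, (T j).Adj (v j) (w j)

/-- The root `(root_1, …, root_d)`. -/
def prodRoot : ∀ j, V j := fun j => (T j).root

/-- The vertices of the component of the tensor product that contains the root. -/
def TensorVertex : Type _ := {v : ∀ j, V j // Linked (tensor T) (prodRoot T) v}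

/-- The component of the tensor product that contains the root, as a directed graph. -/
def tensorComponent : Digraph (TensorVertex T) where
  Adj v w := (tensor T).Adj v.1 w.1

/-- The root of the component of the tensor product. -/
def tensorRoot : TensorVertex T := ⟨prodRoot T, Relation.ReflTransGen.refl⟩

/-- The depth of a vertex in the component of the tensor product that contains the root. -/
def tensorDepth (v : TensorVertex T) : ℕ := depthFrom (tensorComponent T) (tensorRoot T) v

end Product

/-! ### Shifts -/

/-- The complex Hilbert space `l²(V)`. -/
abbrev L2 (V : Type*) := lp (fun _ : V => ℂ) 2

open Classical in
/-- The indicator function of `{v}` as an element of `l²(V)`. -/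
def e {V : Type*} (v : V) : L2 V := lp.single 2 v (1 : ℂ)

/-- `S` is the (bounded) weighted shift with weights `θ` on a directed graph all of whose
vertices have at most one parent: `(S f)(w) = θ_w f(par w)` if `w` has a parent, and
`(S f)(w) = 0` if `w` is a root. -/
def IsWeightedShift {V : Type*} (G : Digraph V) (θ : V → ℝ) (S : L2 V →L[ℂ] L2 V) : Prop :=
  ∀ (f : L2 V) (w : V),
    (∀ u, G.Adj u w → S f w = (θ w : ℂ) * f u) ∧ (IsRoot G w → S f w = 0)

section Multishift

variable {d : ℕ} {V : Fin d → Type*} (T : ∀ j, RootedDirectedTree (V j))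

/-- `S = (S_1, …, S_d)` is the multishift of bounded operators with weights `lam j v` on the
directed Cartesian product: `(S_j f)(v) = lam j v * f(par_j v)` if `v_j` has a parent, where
`par_j v` replaces the coordinate `v_j` of `v` by its parent, and `(S_j f)(v) = 0` if `v_j`
is the root of the `j`-th tree. -/
def IsMultishift (lam : Fin d → (∀ j, V j) → ℝ)
    (S : Fin d → L2 (∀ j, V j) →L[ℂ] L2 (∀ j, V j)) : Prop :=
  ∀ (j : Fin d) (f : L2 (∀ j, V j)) (v : ∀ j, V j),
    (∀ u : V j, (T j).Adj u (v j) → S j f v = (lam j v : ℂ) * f (Function.update v j u)) ∧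
    (v j = (T j).root → S j f v = 0)

/-- The weights that occur in the definition of the multishift are positive. -/
def PositiveWeights (lam : Fin d → (∀ j, V j) → ℝ) : Prop :=
  ∀ j v, v j ≠ (T j).root → 0 < lam j v

/-- The weights `θ_w = √c_{α_w - 1} / √card(sib w)` of the balanced weighted shift. They are used
only at `w ≠ root`, where the depth `α_w` is at least `1`. -/
def balancedWeight (c : ℕ → ℝ) (w : TensorVertex T) : ℝ :=
  Real.sqrt (c (tensorDepth T w - 1)) / Real.sqrt ((sib (tensorComponent T) w).ncard : ℝ)

/-- `S` is the balanced weighted shift associated with the bounded sequence `c` of positive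
numbers, on the component of the tensor product that contains the root. -/
def IsBalancedShift (c : ℕ → ℝ) (S : L2 (TensorVertex T) →L[ℂ] L2 (TensorVertex T)) : Prop :=
  (∀ t, 0 < c t) ∧ BddAbove (Set.range c) ∧
    IsWeightedShift (tensorComponent T) (balancedWeight T c) S

/-- The multishift is spherically balanced: `∑_j ‖S_j e_v‖²` is constant on generations. -/
def SphericallyBalanced (S : Fin d → L2 (∀ j, V j) →L[ℂ] L2 (∀ j, V j)) : Prop :=
  ∀ t, ∀ v ∈ generation T t, ∀ w ∈ generation T t,
    ∑ j, ‖S j (e v)‖ ^ 2 = ∑ j, ‖S j (e w)‖ ^ 2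

end Multishift

/-! ### Tuples of operators -/

section Tuple

variable {d : ℕ} {H : Type*} [NormedAddCommGroup H] [InnerProductSpace ℂ H] [CompleteSpace H]

/-- `S^β = S_1^{β_1} ⋯ S_d^{β_d}`. -/
def tuplePow (S : Fin d → H →L[ℂ] H) (β : Fin d → ℕ) : H →L[ℂ] H :=
  (List.ofFn fun j => S j ^ β j).prod

/-- `Q_S(X) = ∑_j S_j^* X S_j`. -/
def Q (S : Fin d → H →L[ℂ] H) (X : H →L[ℂ] H) : H →L[ℂ] H :=
  ∑ j, ContinuousLinearMap.adjoint (S j) * X * S j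

/-- A joint left invertible `d`-tuple: a commuting `d`-tuple for which `Q_S(I)` is invertible. -/
def JointLeftInvertible (S : Fin d → H →L[ℂ] H) : Prop :=
  (∀ i j, Commute (S i) (S j)) ∧ IsUnit (Q S 1)

end Tuple

/-! ### Reinhardt measures and the integral representation -/

/-- A Reinhardt measure: a Borel probability measure on `ℂ^d` that is carried by the unit sphere
and is invariant under the coordinatewise action of the torus. -/
structure IsReinhardt {d : ℕ} (μ : Measure (EuclideanSpace ℂ (Fin d))) : Prop where
  prob : IsProbabilityMeasure μ
  sphere : μ (Metric.sphere (0 : EuclideanSpace ℂ (Fin d)) 1)ᶜ = 0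
  invariant : ∀ ζ : Fin d → ℂ, (∀ j, ‖ζ j‖ = 1) →
    ∀ Δ ⊆ Metric.sphere (0 : EuclideanSpace ℂ (Fin d)) 1, MeasurableSet Δ →
      μ ((fun z : EuclideanSpace ℂ (Fin d) => WithLp.toLp 2 fun j => ζ j * z j) '' Δ) = μ Δ

/-- The multi-indices `β ∈ ℕ^d` with `|β| ≤ k`. -/
def multiIndex (d k : ℕ) : Finset (Fin d → ℕ) :=
  (Fintype.piFinset fun _ => Finset.range (k + 1)).filter fun β => ∑ j, β j ≤ k

theorem mem_multiIndex {d k : ℕ} (β : Fin d → ℕ) :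
    β ∈ multiIndex d k ↔ ∑ j, β j ≤ k := by
  simp only [multiIndex, Finset.mem_filter, Fintype.mem_piFinset, Finset.mem_range,
    and_iff_right_iff_imp]
  intro h j
  have := Finset.single_le_sum (f := β) (fun i _ => Nat.zero_le _) (Finset.mem_univ j)
  omega

/-- `f_k = ∑_{|β| ≤ k} a_β S^β x`. -/
def polySum {d : ℕ} {H : Type*} [NormedAddCommGroup H] [InnerProductSpace ℂ H]
    [CompleteSpace H] (S : Fin d → H →L[ℂ] H) (x : H) (a : (Fin d → ℕ) → ℂ) (k : ℕ) : H :=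
  ∑ β ∈ multiIndex d k, a β • tuplePow S β x

/-- `f_{θ,k}(z) = ∑_{|β| ≤ k} a_β z^β R^{|β|} y`. -/
def polySumAt {d : ℕ} {H : Type*} [NormedAddCommGroup H] [InnerProductSpace ℂ H]
    (R : H →L[ℂ] H) (y : H) (a : (Fin d → ℕ) → ℂ) (k : ℕ) (z : EuclideanSpace ℂ (Fin d)) : H :=
  ∑ β ∈ multiIndex d k, (a β * ∏ j, z j ^ β j) • (R ^ (∑ j, β j)) y

/-- `‖f_k‖² = ∫ ‖f_{θ,k}(z)‖² dμ(z)` for all `k` and all coefficients. -/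
def IntegralRep {d : ℕ} {H K : Type*} [NormedAddCommGroup H] [InnerProductSpace ℂ H]
    [CompleteSpace H] [NormedAddCommGroup K] [InnerProductSpace ℂ K]
    (S : Fin d → H →L[ℂ] H) (x : H) (R : K →L[ℂ] K) (y : K)
    (μ : Measure (EuclideanSpace ℂ (Fin d))) : Prop :=
  ∀ (a : (Fin d → ℕ) → ℂ) (k : ℕ),
    ‖polySum S x a k‖ ^ 2 =
      ∫ z in Metric.sphere (0 : EuclideanSpace ℂ (Fin d)) 1, ‖polySumAt R y a k z‖ ^ 2 ∂μ

end MultishiftTree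

end

/-!
The idea is to reduce everything to the numbers `‖S^β e_v‖²`, `‖R^n e_u‖²` and the moments
`∫ ‖z^β‖² dμ`.

The multishift `S` and the balanced shift `R` are both graded (`IsGradedShift`): they raise the
level `|α_v|`, respectively the depth in the tensor component, by one, and they map distinct
indicator functions to functions with disjoint supports. Hence `Q` maps diagonal operators to
diagonal operators, and once `∑ j, ‖S_j e_v‖²` is a function `c` of the level alone,
`Q^n(I) e_v = ∏_{i < n} c(|α_v| + i) e_v` (`IsGradedShift.Q_iterate_apply_e`). For the balanced
shift, `‖R e_u‖² = c(α_u)` by the choice of the weights, so the same formula describes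
`(R^n)^* R^n`. As every level occurs in both graphs, the two diagonal operators have the same
set of diagonal entries and hence the same norm (`norm_Q_iterate`).

The vectors `S^β e_v` are pairwise orthogonal, and so are the monomials with respect to a Reinhardt
measure. Therefore the integral representation is equivalent to
`‖S^β e_v‖² = ‖R^{|β|} e_𝔳‖² ∫ ‖z^β‖² dμ` for all `β` (`IsReinhardt.integralRep_iff`). In degree one
and on the unit sphere this gives `∑ j, ‖S_j e_v‖² = c(|α_v|)`, that is, spherical balancedness.

Conversely, if `S` is spherically balanced, then `m β = ‖S^β e_v‖² / ‖R^{|β|} e_𝔳‖²` is a nonnegative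
family with `m 0 = 1` and `∑ j, m (β + ε_j) = m β`. Such families form a compact convex set. Its
extreme points are multiplicative, so they are the moments of Dirac measures on the standard simplex,
and the Krein-Milman theorem together with the compactness of the space of probability measures
shows that every such family is the moment family of a probability measure on the simplex
(`exists_measure_of_mem_simplexMoments`). Spreading that measure over the torus orbits with Haar
measure yields the required Reinhardt measure (`reinhardtOf`).

The convergence almost everywhere follows from monotone convergence, because the homogeneous parts
of the `f_{θ,k}(z)` are orthogonal (`IntegralRep.exists_limit`).
-/

namespace MultishiftTree

/-! ### Depth in graphs with unique parents -/

section Graph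

variable {V : Type*} {G : Digraph V} {r : V}

theorem mem_chiN_zero {v : V} : v ∈ chiN G 0 {r} ↔ v = r := by
  simp [chiN]

theorem mem_chiN_succ {n : ℕ} {v : V} :
    v ∈ chiN G (n + 1) {r} ↔ ∃ u ∈ chiN G n {r}, G.Adj u v := by
  simp [chiN, Function.iterate_succ_apply', chi]

variable (hG : ∀ ⦃u u' w⦄, G.Adj u w → G.Adj u' w → u = u')
include hG

theorem sib_eq_children {u w : V}
    (h : G.Adj u w) : sib G w = {x | G.Adj u x} := by
  ext x
  refine ⟨?_, fun hx => ⟨u, h, hx⟩⟩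
  rintro ⟨u', hu', hx⟩
  rwa [hG hu' h] at hx

variable (hr : IsRoot G r)
include hr

theorem eq_of_mem_chiN {m n : ℕ} {v : V} (hm : v ∈ chiN G m {r}) (hn : v ∈ chiN G n {r}) :
    m = n := by
  induction m generalizing n v with
  | zero =>
    rw [mem_chiN_zero] at hm
    subst hm
    cases n with
    | zero => rfl
    | succ n =>
      obtain ⟨u, -, h⟩ := mem_chiN_succ.1 hn
      exact (hr u h).elim
  | succ m ih =>
    obtain ⟨u, hu, huv⟩ := mem_chiN_succ.1 hm
    cases n with
    | zero =>
      rw [mem_chiN_zero] at hn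
      subst hn
      exact (hr u huv).elim
    | succ n =>
      obtain ⟨u', hu', huv'⟩ := mem_chiN_succ.1 hn
      rw [hG huv' huv] at hu'
      rw [ih hu hu']

theorem depthFrom_eq {n : ℕ} {v : V} (h : v ∈ chiN G n {r}) : depthFrom G r v = n :=
  eq_of_mem_chiN hG hr (Nat.sInf_mem (s := {n | v ∈ chiN G n {r}}) ⟨n, h⟩) h

theorem depthFrom_root : depthFrom G r r = 0 :=
  depthFrom_eq hG hr (mem_chiN_zero.2 rfl)

/-- Being an iterated child of the root propagates along edges in both directions; going up, the
unique parent has to be the vertex met on the way down from the root. -/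
theorem exists_mem_chiN_of_linked {v : V} (h : Linked G r v) : ∃ n, v ∈ chiN G n {r} := by
  induction h with
  | refl => exact ⟨0, mem_chiN_zero.2 rfl⟩
  | tail _ hab ih =>
    obtain ⟨n, hn⟩ := ih
    rcases hab with hab | hba
    · exact ⟨n + 1, mem_chiN_succ.2 ⟨_, hn, hab⟩⟩
    · cases n with
      | zero =>
        rw [mem_chiN_zero] at hn
        subst hn
        exact (hr _ hba).elim
      | succ n =>
        obtain ⟨u, hu, huv⟩ := mem_chiN_succ.1 hn
        exact ⟨n, hG huv hba ▸ hu⟩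

theorem depthFrom_adj {u v : V} (hu : Linked G r u) (huv : G.Adj u v) :
    depthFrom G r v = depthFrom G r u + 1 := by
  obtain ⟨n, hn⟩ := exists_mem_chiN_of_linked hG hr hu
  rw [depthFrom_eq hG hr hn, depthFrom_eq hG hr (mem_chiN_succ.2 ⟨u, hn, huv⟩)]

end Graph

namespace RootedDirectedTree

variable {V : Type*} (T : RootedDirectedTree V)

theorem parent_unique ⦃u u' w : V⦄ (h : T.Adj u w) (h' : T.Adj u' w) : u = u' := by
  have hw : w ≠ T.root := fun hw => T.isRoot_root u (hw ▸ h)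
  exact (T.unique_parent w hw).unique h h'

theorem depth_root : T.depth T.root = 0 :=
  depthFrom_root T.parent_unique T.isRoot_root

theorem depth_adj {u v : V} (h : T.Adj u v) : T.depth v = T.depth u + 1 :=
  depthFrom_adj T.parent_unique T.isRoot_root (T.connected _ _) h

theorem eq_root_or_exists_parent (v : V) : v = T.root ∨ ∃ u, T.Adj u v := by
  by_cases h : v = T.root
  · exact Or.inl h
  · exact Or.inr (T.unique_parent v h).exists

theorem exists_depth_eq (hleaf : T.Leafless) (n : ℕ) : ∃ v, T.depth v = n := by
  induction n with
  | zero => exact ⟨_, T.depth_root⟩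
  | succ n ih =>
    obtain ⟨u, hu⟩ := ih
    obtain ⟨v, hv⟩ := hleaf u
    exact ⟨v, by rw [T.depth_adj hv, hu]⟩

end RootedDirectedTree

/-! ### Depth in the products -/

section Product

variable {d : ℕ} {V : Fin d → Type*} (T : ∀ j, RootedDirectedTree (V j))

theorem exists_mem_generation (hd : 0 < d) (hleaf : ∀ j, (T j).Leafless) (t : ℕ) :
    ∃ v, v ∈ generation T t := by
  obtain ⟨x, hx⟩ := (T ⟨0, hd⟩).exists_depth_eq (hleaf _) t
  refine ⟨Function.update (prodRoot T) ⟨0, hd⟩ x, ?_⟩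
  change ∑ j, _ = t
  rw [Finset.sum_eq_single (⟨0, hd⟩ : Fin d)]
  · simp [depthVec, hx]
  · intro j _ hj
    simp [depthVec, Function.update_of_ne hj, prodRoot, RootedDirectedTree.depth_root]
  · simp

theorem tensorComponent_parent_unique ⦃u u' w : TensorVertex T⦄
    (h : (tensorComponent T).Adj u w) (h' : (tensorComponent T).Adj u' w) : u = u' :=
  Subtype.ext (funext fun j => (T j).parent_unique (h j) (h' j))

theorem isRoot_tensorRoot (hd : 0 < d) : IsRoot (tensorComponent T) (tensorRoot T) :=
  fun u hu => (T ⟨0, hd⟩).isRoot_root (u.1 ⟨0, hd⟩) (hu ⟨0, hd⟩)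

theorem linked_tensorRoot (v : TensorVertex T) : Linked (tensorComponent T) (tensorRoot T) v := by
  obtain ⟨v, hv⟩ := v
  induction hv with
  | refl => exact Relation.ReflTransGen.refl
  | tail hab hbc ih => exact Relation.ReflTransGen.tail ih hbc

theorem tensorDepth_adj (hd : 0 < d) {u w : TensorVertex T} (h : (tensorComponent T).Adj u w) :
    tensorDepth T w = tensorDepth T u + 1 :=
  depthFrom_adj (tensorComponent_parent_unique T) (isRoot_tensorRoot T hd)
    (linked_tensorRoot T u) h

theorem tensorComponent_exists_child (hleaf : ∀ j, (T j).Leafless) (u : TensorVertex T) :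
    ∃ w, (tensorComponent T).Adj u w := by
  choose w hw using fun j => hleaf j (u.1 j)
  exact ⟨⟨w, Relation.ReflTransGen.tail u.2 (Or.inl hw)⟩, hw⟩

theorem tensorComponent_children_finite (hfin : ∀ j, (T j).LocallyFinite) (u : TensorVertex T) :
    {w | (tensorComponent T).Adj u w}.Finite := by
  have h : (Set.univ.pi fun j => {x | (T j).Adj (u.1 j) x}).Finite :=
    Set.Finite.pi fun j => hfin j (u.1 j)
  exact (h.preimage Subtype.val_injective.injOn).subset fun w hw => fun j _ => hw j

end Product

/-! ### The Hilbert space `l²` and operators given by their action on indicator functions -/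

section L2

variable {W : Type*}

open Classical in
theorem e_apply (v w : W) : (e v : L2 W) w = if w = v then 1 else 0 := by
  simp [e, lp.single_apply, Pi.single_apply]

theorem e_apply_self (v : W) : (e v : L2 W) v = 1 := by simp [e_apply]

theorem e_apply_ne {v w : W} (h : w ≠ v) : (e v : L2 W) w = 0 := by simp [e_apply, h]

theorem norm_e (v : W) : ‖(e v : L2 W)‖ = 1 := by
  classical
  simp [e, lp.norm_single]

theorem inner_e_left (v : W) (f : L2 W) : inner ℂ (e v) f = f v := by
  classical
  unfold e
  rw [lp.inner_single_left]
  simp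

theorem inner_e_right (v : W) (f : L2 W) : inner ℂ f (e v) = starRingEnd ℂ (f v) := by
  rw [← inner_e_left, inner_conj_symm]

theorem norm_sq_eq_tsum (f : L2 W) : HasSum (fun v => ‖f v‖ ^ 2) (‖f‖ ^ 2) := by
  simpa using lp.hasSum_norm (p := 2) (by simp) f

theorem inner_eq_zero_of_disjoint {f g : L2 W} (h : ∀ w, f w ≠ 0 → g w ≠ 0 → False) :
    inner ℂ f g = 0 := by
  rw [lp.inner_eq_tsum]
  convert tsum_zero with w
  by_cases hf : f w = 0
  · simp [hf]
  · have : g w = 0 := by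
      by_contra hg
      exact h w hf hg
    simp [this]

theorem clm_ext_e {F : Type*} [NormedAddCommGroup F] [NormedSpace ℂ F] {X Y : L2 W →L[ℂ] F}
    (h : ∀ v, X (e v) = Y (e v)) : X = Y := by
  classical
  refine lp.ext_continuousLinearMap (by simp) fun v => ?_
  ext
  simpa [e] using h v

theorem apply_eq_of_diagonal {X : L2 W →L[ℂ] L2 W} {x : W → ℂ}
    (hX : ∀ v, X (e v) = x v • e v) (f : L2 W) (w : W) : X f w = x w * f w := by
  have : (lp.evalCLM ℂ (fun _ : W => ℂ) 2 w).comp X =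
      x w • lp.evalCLM ℂ (fun _ : W => ℂ) 2 w := by
    refine clm_ext_e fun v => ?_
    change X (e v) w = x w * (e v : L2 W) w
    rw [hX]
    by_cases h : w = v
    · subst h; simp
    · simp [e_apply_ne h]
  exact congrArg (fun Y : L2 W →L[ℂ] ℂ => Y f) this

/-- The norm of a diagonal operator is bounded by that of another one, possibly on a different
space, which has all the diagonal entries of the first one. -/
theorem norm_le_of_diagonal {W' : Type*} {X : L2 W →L[ℂ] L2 W} {X' : L2 W' →L[ℂ] L2 W'}
    {x : W → ℂ} {x' : W' → ℂ} (hX : ∀ v, X (e v) = x v • e v)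
    (hX' : ∀ v, X' (e v) = x' v • e v) (h : ∀ v, ∃ v', x v = x' v') : ‖X‖ ≤ ‖X'‖ := by
  have hx : ∀ v, ‖x v‖ ≤ ‖X'‖ := by
    intro v
    obtain ⟨v', hv⟩ := h v
    have := X'.le_opNorm (e v')
    rwa [hX', norm_smul, norm_e, mul_one, mul_one, ← hv] at this
  refine X.opNorm_le_bound (norm_nonneg _) fun f => ?_
  refine abs_le_of_sq_le_sq' ?_ (by positivity) |>.2
  rw [mul_pow]
  refine hasSum_le (fun v => ?_) (norm_sq_eq_tsum (X f))
    ((norm_sq_eq_tsum f).mul_left (‖X'‖ ^ 2))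
  rw [apply_eq_of_diagonal hX, norm_mul, mul_pow]
  gcongr
  exact hx v

/-- If `g` lives on the level `δ` of a grading and `A` raises levels by `ε`, then `A g` lives on
the level `δ + ε`. -/
theorem support_apply_of_level {M : Type*} [Add M] {D : W → M} {δ ε : M} {g : L2 W}
    {A : L2 W →L[ℂ] L2 W} (hg : ∀ w, g w ≠ 0 → D w = δ)
    (hA : ∀ v w, A (e v) w ≠ 0 → D w = D v + ε) (w : W) (hw : A g w ≠ 0) : D w = δ + ε := by
  by_contra hne
  apply hw
  rw [← inner_e_left, ← ContinuousLinearMap.adjoint_inner_left]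
  refine inner_eq_zero_of_disjoint fun v hv hgv => ?_
  apply hv
  rw [← inner_e_left, ContinuousLinearMap.adjoint_inner_right, inner_e_right]
  by_contra h0
  have hAv : A (e v) w ≠ 0 := by
    intro h
    simp [h] at h0
  exact hne (by rw [hA v w hAv, hg v hgv])

theorem norm_sq_sum_of_pairwise_orthogonal {H ι : Type*} [NormedAddCommGroup H]
    [InnerProductSpace ℂ H] (s : Finset ι) (x : ι → H)
    (h : ∀ i j, i ≠ j → inner ℂ (x i) (x j) = 0) : ‖∑ i ∈ s, x i‖ ^ 2 = ∑ i ∈ s, ‖x i‖ ^ 2 := by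
  classical
  have : ((‖∑ i ∈ s, x i‖ ^ 2 : ℝ) : ℂ) = ((∑ i ∈ s, ‖x i‖ ^ 2 : ℝ) : ℂ) := by
    push_cast
    rw [← RCLike.ofReal_eq_complex_ofReal, ← inner_self_eq_norm_sq_to_K, sum_inner]
    refine Finset.sum_congr rfl fun i hi => ?_
    rw [inner_sum, Finset.sum_eq_single i]
    · rw [inner_self_eq_norm_sq_to_K, RCLike.ofReal_eq_complex_ofReal]
    · intro j _ hj
      exact h i j hj.symm
    · exact fun h => (h hi).elim
  exact_mod_cast this

end L2

/-! ### Graded shifts and the iterates of `Q` -/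

section Graded

variable {W : Type*} {d : ℕ}

/-- Abstract form of a (multi)shift: with respect to the level function `h`, each `A j (e v)` is
supported one level above `v`, and for fixed `j` the supports for different `v` are disjoint. -/
structure IsGradedShift (h : W → ℕ) (A : Fin d → L2 W →L[ℂ] L2 W) : Prop where
  level : ∀ j v w, A j (e v) w ≠ 0 → h w = h v + 1
  disjoint : ∀ j v v' w, A j (e v) w ≠ 0 → A j (e v') w ≠ 0 → v = v'

variable {h : W → ℕ} {A : Fin d → L2 W →L[ℂ] L2 W}

theorem inner_Q_one {H : Type*} [NormedAddCommGroup H] [InnerProductSpace ℂ H] [CompleteSpace H]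
    (A : Fin d → H →L[ℂ] H) (x : H) :
    inner ℂ (Q A 1 x) x = ((∑ j, ‖A j x‖ ^ 2 : ℝ) : ℂ) := by
  have : Q A 1 x = ∑ j, ContinuousLinearMap.adjoint (A j) (A j x) := by
    simp [Q]
  rw [this, sum_inner]
  push_cast
  refine Finset.sum_congr rfl fun j _ => ?_
  rw [ContinuousLinearMap.adjoint_inner_left, inner_self_eq_norm_sq_to_K]
  rfl

theorem IsGradedShift.Q_apply_e (hA : IsGradedShift h A) {c : ℕ → ℝ}
    (hc : ∀ v, ∑ j, ‖A j (e v)‖ ^ 2 = c (h v)) {X : L2 W →L[ℂ] L2 W} {y : ℕ → ℝ}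
    (hX : ∀ v, X (e v) = (y (h v) : ℂ) • e v) (v : W) :
    Q A X (e v) = ((c (h v) * y (h v + 1) : ℝ) : ℂ) • e v := by
  have hXA : ∀ j, X (A j (e v)) = (y (h v + 1) : ℂ) • A j (e v) := by
    intro j
    ext w
    rw [apply_eq_of_diagonal hX, lp.coeFn_smul, Pi.smul_apply, smul_eq_mul]
    by_cases hw : A j (e v) w = 0
    · simp [hw]
    · rw [hA.level j v w hw]
  have hQ : Q A X (e v) = (y (h v + 1) : ℂ) •
      ∑ j, ContinuousLinearMap.adjoint (A j) (A j (e v)) := by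
    rw [Finset.smul_sum, Q, sum_apply]
    refine Finset.sum_congr rfl fun j _ => ?_
    change ContinuousLinearMap.adjoint (A j) (X (A j (e v))) = _
    rw [hXA, map_smul]
  rw [hQ]
  ext w
  rw [lp.coeFn_smul, lp.coeFn_smul, Pi.smul_apply, Pi.smul_apply, smul_eq_mul, smul_eq_mul,
    ← inner_e_left, inner_sum]
  simp_rw [ContinuousLinearMap.adjoint_inner_right]
  by_cases hw : w = v
  · subst hw
    have : ∑ j, inner ℂ (A j (e w)) (A j (e w)) = ((c (h w) : ℝ) : ℂ) := by
      rw [← hc]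
      push_cast
      exact Finset.sum_congr rfl fun j _ => by rw [inner_self_eq_norm_sq_to_K]; rfl
    rw [this, e_apply_self]
    push_cast
    ring
  · rw [e_apply_ne hw, mul_zero, Finset.sum_eq_zero, mul_zero]
    intro j _
    exact inner_eq_zero_of_disjoint fun u hu hu' => hw (hA.disjoint j w v u hu hu')

theorem IsGradedShift.Q_iterate_apply_e (hA : IsGradedShift h A) {c : ℕ → ℝ}
    (hc : ∀ v, ∑ j, ‖A j (e v)‖ ^ 2 = c (h v)) (n : ℕ) (v : W) :
    ((Q A)^[n] 1) (e v) = ((∏ i ∈ Finset.range n, c (h v + i) : ℝ) : ℂ) • e v := by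
  induction n generalizing v with
  | zero => simp
  | succ n ih =>
    rw [Function.iterate_succ_apply',
      hA.Q_apply_e hc (y := fun t => ∏ i ∈ Finset.range n, c (t + i)) ih, Finset.prod_range_succ']
    simp only [add_zero, mul_comm (c (h v)), add_assoc, add_comm 1]

/-- On a vector that lives on one level, `∑ j, ‖A j g‖²` is the value of `c` at that level
times `‖g‖²`. -/
theorem IsGradedShift.sum_norm_sq (hA : IsGradedShift h A) {c : ℕ → ℝ}
    (hc : ∀ v, ∑ j, ‖A j (e v)‖ ^ 2 = c (h v)) {g : L2 W} {t : ℕ}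
    (hg : ∀ w, g w ≠ 0 → h w = t) : ∑ j, ‖A j g‖ ^ 2 = c t * ‖g‖ ^ 2 := by
  have hQ : ∀ v, Q A 1 (e v) = (c (h v) : ℂ) • e v := by
    intro v
    simpa using hA.Q_apply_e hc (X := 1) (y := fun _ => 1) (by simp) v
  have hQg : Q A 1 g = (c t : ℂ) • g := by
    ext w
    rw [apply_eq_of_diagonal hQ, lp.coeFn_smul, Pi.smul_apply, smul_eq_mul]
    by_cases hw : g w = 0
    · simp [hw]
    · rw [hg w hw]
  have := inner_Q_one A g
  rw [hQg, inner_smul_left, inner_self_eq_norm_sq_to_K, Complex.conj_ofReal] at this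
  have h2 : ((c t * ‖g‖ ^ 2 : ℝ) : ℂ) = ((∑ j, ‖A j g‖ ^ 2 : ℝ) : ℂ) := by
    rw [← this]; push_cast; rfl
  exact_mod_cast h2.symm

/-- For a single operator, `Q^n(I) = (R^n)^* R^n`. -/
theorem Q_iterate_single {H : Type*} [NormedAddCommGroup H] [InnerProductSpace ℂ H]
    [CompleteSpace H] (R : H →L[ℂ] H) (n : ℕ) :
    (Q fun _ : Fin 1 => R)^[n] 1 = ContinuousLinearMap.adjoint (R ^ n) * R ^ n := by
  induction n with
  | zero => simp [← ContinuousLinearMap.star_eq_adjoint]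
  | succ n ih =>
    rw [Function.iterate_succ_apply', ih]
    simp only [Q, Finset.univ_unique, Finset.sum_const, Finset.card_singleton, one_smul,
      ← ContinuousLinearMap.star_eq_adjoint, pow_succ, star_mul, mul_assoc]

theorem norm_Q_iterate_single {H : Type*} [NormedAddCommGroup H] [InnerProductSpace ℂ H]
    [CompleteSpace H] (R : H →L[ℂ] H) (n : ℕ) :
    ‖(Q fun _ : Fin 1 => R)^[n] 1‖ = ‖R ^ n‖ ^ 2 := by
  rw [Q_iterate_single, ← ContinuousLinearMap.star_eq_adjoint, CStarRing.norm_star_mul_self, sq]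

/-- A single graded operator multiplies the squared norms of the `e v` by a product of values of
`c` over consecutive levels. -/
theorem IsGradedShift.norm_pow_apply_e {R : L2 W →L[ℂ] L2 W}
    (hR : IsGradedShift h fun _ : Fin 1 => R) {c : ℕ → ℝ} (hc : ∀ v, ‖R (e v)‖ ^ 2 = c (h v))
    (n : ℕ) (v : W) : ‖(R ^ n) (e v)‖ ^ 2 = ∏ i ∈ Finset.range n, c (h v + i) := by
  have h1 := hR.Q_iterate_apply_e (by simpa using hc) n v
  rw [Q_iterate_single] at h1
  have h2 : inner ℂ ((ContinuousLinearMap.adjoint (R ^ n) * R ^ n) (e v)) (e v) =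
      ((‖(R ^ n) (e v)‖ ^ 2 : ℝ) : ℂ) := by
    change inner ℂ (ContinuousLinearMap.adjoint (R ^ n) ((R ^ n) (e v))) (e v) = _
    rw [ContinuousLinearMap.adjoint_inner_left, inner_self_eq_norm_sq_to_K]
    push_cast
    rfl
  rw [h1, inner_smul_left, inner_e_left, e_apply_self, Complex.conj_ofReal, mul_one] at h2
  exact_mod_cast h2.symm

theorem IsGradedShift.pow_level {R : L2 W →L[ℂ] L2 W}
    (hR : IsGradedShift h fun _ : Fin 1 => R) (n : ℕ) (v w : W) (hw : (R ^ n) (e v) w ≠ 0) :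
    h w = h v + n := by
  induction n generalizing w with
  | zero =>
    by_contra hne
    exact hw (e_apply_ne fun h => hne (by simp [h]))
  | succ n ih =>
    rw [pow_succ'] at hw
    exact support_apply_of_level (D := h) (ε := 1) ih (fun v w => hR.level 0 v w) w hw

end Graded

/-! ### The moment problem on the simplex -/

section Moments

variable {d : ℕ}

theorem multiIndex_induction {P : (Fin d → ℕ) → Prop} (zero : P 0)
    (step : ∀ β j, P β → P (β + Pi.single j 1)) (β : Fin d → ℕ) : P β := by
  induction hn : ∑ j, β j generalizing β with
  | zero =>
    have : β = 0 := by
      funext j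
      exact (Finset.sum_eq_zero_iff.1 hn) j (Finset.mem_univ j)
    exact this ▸ zero
  | succ n ih =>
    obtain ⟨j, hj⟩ : ∃ j, β j ≠ 0 := by
      by_contra! h
      simp [h] at hn
    have hβ : β - Pi.single j 1 + Pi.single j 1 = β := by
      funext i
      by_cases hi : i = j
      · subst hi
        simp only [Pi.add_apply, Pi.sub_apply, Pi.single_eq_same]
        omega
      · simp [hi]
    rw [← hβ]
    refine step _ _ (ih _ ?_)
    have hsum : ∑ i, (β - Pi.single j 1 + Pi.single j 1 : Fin d → ℕ) i = n + 1 := by rw [hβ, hn]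
    have hone : ∑ i, (Pi.single j 1 : Fin d → ℕ) i = 1 := by simp
    simp only [Pi.add_apply, Finset.sum_add_distrib, hone] at hsum
    omega

theorem prod_pow_add_single {M : Type*} [CommMonoid M] (x : Fin d → M) (β : Fin d → ℕ)
    (j : Fin d) : ∏ i, x i ^ (β + Pi.single j 1 : Fin d → ℕ) i = (∏ i, x i ^ β i) * x j := by
  simp only [Pi.add_apply, pow_add, Finset.prod_mul_distrib]
  congr 1
  rw [Finset.prod_eq_single j]
  · simp
  · intro i _ hi
    simp [hi]
  · simp

/-- The candidate moment families of probability measures on the standard simplex: nonnegative,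
normalized, and compatible with the relation `∑ j, x j = 1`. -/
def simplexMoments (d : ℕ) : Set ((Fin d → ℕ) → ℝ) :=
  {m | (∀ β, 0 ≤ m β) ∧ m 0 = 1 ∧ ∀ β, ∑ j, m (β + Pi.single j 1) = m β}

theorem apply_add_single_le {m : (Fin d → ℕ) → ℝ} (hm : m ∈ simplexMoments d) (β : Fin d → ℕ)
    (j : Fin d) : m (β + Pi.single j 1) ≤ m β := by
  rw [← hm.2.2 β]
  exact Finset.single_le_sum (f := fun j => m (β + Pi.single j 1)) (fun i _ => hm.1 _)
    (Finset.mem_univ j)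

theorem apply_add_le {m : (Fin d → ℕ) → ℝ} (hm : m ∈ simplexMoments d) (γ β : Fin d → ℕ) :
    m (γ + β) ≤ m γ := by
  induction β using multiIndex_induction with
  | zero => simp
  | step β j ih =>
    rw [← add_assoc]
    exact (apply_add_single_le hm _ j).trans ih

theorem isCompact_simplexMoments : IsCompact (simplexMoments d) := by
  have hsub : simplexMoments d ⊆ Set.univ.pi fun _ => Set.Icc (0 : ℝ) 1 := by
    intro m hm β _
    refine ⟨hm.1 β, ?_⟩
    have := apply_add_le hm 0 β
    rwa [zero_add, hm.2.1] at this
  refine (isCompact_univ_pi fun _ => isCompact_Icc).of_isClosed_subset ?_ hsub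
  have h1 : IsClosed {m : (Fin d → ℕ) → ℝ | ∀ β, 0 ≤ m β} := by
    simp only [Set.ofPred_forall]
    exact isClosed_iInter fun β => isClosed_le continuous_const (continuous_apply β)
  have h2 : IsClosed {m : (Fin d → ℕ) → ℝ | m 0 = 1} :=
    isClosed_eq (continuous_apply _) continuous_const
  have h3 : IsClosed {m : (Fin d → ℕ) → ℝ | ∀ β, ∑ j, m (β + Pi.single j 1) = m β} := by
    simp only [Set.ofPred_forall]
    exact isClosed_iInter fun β => isClosed_eq
      (continuous_finsetSum _ fun j _ => continuous_apply _) (continuous_apply β)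
  exact h1.inter (h2.inter h3)

theorem convex_simplexMoments : Convex ℝ (simplexMoments d) := by
  intro m hm m' hm' a b ha hb hab
  refine ⟨fun β => ?_, ?_, fun β => ?_⟩
  · exact add_nonneg (mul_nonneg ha (hm.1 β)) (mul_nonneg hb (hm'.1 β))
  · simp [hm.2.1, hm'.2.1, hab]
  · simp only [Pi.add_apply, Pi.smul_apply, smul_eq_mul, Finset.sum_add_distrib,
      ← Finset.mul_sum, hm.2.2, hm'.2.2]

/-- Extreme moment families are multiplicative: with `a = m (single j 1)`, the family `m` is the
convex combination of `β ↦ m (β + single j 1) / a` and `β ↦ (m β - m (β + single j 1)) / (1 - a)`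
with weights `a` and `1 - a`. -/
theorem apply_add_single_of_mem_extremePoints {m : (Fin d → ℕ) → ℝ}
    (hm : m ∈ (simplexMoments d).extremePoints ℝ) (β : Fin d → ℕ) (j : Fin d) :
    m (β + Pi.single j 1) = m β * m (Pi.single j 1) := by
  obtain ⟨hm, hext⟩ := hm
  set a := m (Pi.single j 1) with ha
  have hle : ∀ β : Fin d → ℕ, m (β + Pi.single j 1) ≤ a := fun β => by
    rw [add_comm]; exact apply_add_le hm _ _
  have ha0 : 0 ≤ a := hm.1 _
  have ha1 : a ≤ 1 := by
    have := apply_add_single_le hm 0 j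
    rwa [zero_add, hm.2.1] at this
  rcases ha0.eq_or_lt with h0 | h0
  · rw [← h0, mul_zero]
    exact le_antisymm ((hle β).trans h0.ge) (hm.1 _)
  rcases ha1.eq_or_lt with h1 | h1
  · rw [h1, mul_one, ← hm.2.2 β]
    symm
    refine Finset.sum_eq_single j (fun i _ hij => ?_) (by simp)
    -- all the mass `1 = ∑ i, m (single i 1)` sits at `j`
    have hsum := hm.2.2 0
    simp only [zero_add, hm.2.1] at hsum
    rw [← Finset.add_sum_erase _ _ (Finset.mem_univ j), ← ha, h1] at hsum
    have hz : ∑ i ∈ Finset.univ.erase j, m (Pi.single i 1) = 0 := by linarith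
    have hi := (Finset.sum_eq_zero_iff_of_nonneg fun i _ => hm.1 _).1 hz i (by simp [hij])
    have := apply_add_le hm (Pi.single i 1) β
    rw [add_comm] at this
    exact le_antisymm (this.trans hi.le) (hm.1 _)
  · have hswap : ∀ (β : Fin d → ℕ) (i : Fin d), β + Pi.single i 1 + Pi.single j 1 =
        β + Pi.single j 1 + Pi.single i 1 := fun β i => add_right_comm _ _ _
    have h1' : 0 < 1 - a := sub_pos.2 h1
    have hm₁ : (fun β => m (β + Pi.single j 1) / a) ∈ simplexMoments d := by
      refine ⟨fun β => div_nonneg (hm.1 _) ha0, ?_, fun β => ?_⟩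
      · simp only [zero_add, ← ha]
        exact div_self h0.ne'
      · simp only [← Finset.sum_div, hswap, hm.2.2]
    have hm₂ : (fun β => (m β - m (β + Pi.single j 1)) / (1 - a)) ∈ simplexMoments d := by
      refine ⟨fun β => div_nonneg (sub_nonneg.2 (apply_add_single_le hm _ _)) h1'.le, ?_,
        fun β => ?_⟩
      · simp only [zero_add, ← ha, hm.2.1]
        exact div_self h1'.ne'
      · simp only [← Finset.sum_div, Finset.sum_sub_distrib, hswap, hm.2.2]
    have hseg := hext hm₁ hm₂ ⟨a, 1 - a, h0, h1', by ring, by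
      funext β
      simp only [Pi.add_apply, Pi.smul_apply, smul_eq_mul]
      field_simp
      ring⟩
    have := congrFun hseg β
    rw [← this]
    field_simp

/-- The moment family of a probability measure on the standard simplex. -/
noncomputable def momentsOf (ν : ProbabilityMeasure (stdSimplex ℝ (Fin d))) (β : Fin d → ℕ) : ℝ :=
  ∫ x, ∏ j, x.1 j ^ β j ∂(ν : Measure (stdSimplex ℝ (Fin d)))

theorem continuous_monomial_stdSimplex (β : Fin d → ℕ) :
    Continuous fun x : stdSimplex ℝ (Fin d) => ∏ j, x.1 j ^ β j :=
  continuous_finsetProd _ fun j _ => ((continuous_apply j).comp continuous_subtype_val).pow _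

theorem continuous_momentsOf : Continuous (momentsOf (d := d)) :=
  continuous_pi fun β => ProbabilityMeasure.continuous_integral_boundedContinuousFunction
    (BoundedContinuousFunction.mkOfCompact ⟨_, continuous_monomial_stdSimplex β⟩)

theorem integrable_of_continuous_stdSimplex {f : stdSimplex ℝ (Fin d) → ℝ} (hf : Continuous f)
    (ν : Measure (stdSimplex ℝ (Fin d))) [IsFiniteMeasure ν] : Integrable f ν :=
  (BoundedContinuousFunction.mkOfCompact ⟨f, hf⟩).integrable ν

theorem convex_range_momentsOf : Convex ℝ (Set.range (momentsOf (d := d))) := by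
  rintro _ ⟨ν, rfl⟩ _ ⟨ν', rfl⟩ a b ha hb hab
  let ρ : Measure (stdSimplex ℝ (Fin d)) :=
    ENNReal.ofReal a • (ν : Measure _) + ENNReal.ofReal b • (ν' : Measure _)
  have hρ : IsProbabilityMeasure ρ := ⟨by
    simp [ρ, ← ENNReal.ofReal_add ha hb, hab]⟩
  refine ⟨⟨ρ, hρ⟩, ?_⟩
  funext β
  have hf := continuous_monomial_stdSimplex β
  change ∫ x, _ ∂ρ = _
  rw [integral_add_measure
    ((integrable_of_continuous_stdSimplex hf _).smul_measure ENNReal.ofReal_ne_top)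
    ((integrable_of_continuous_stdSimplex hf _).smul_measure ENNReal.ofReal_ne_top),
    integral_smul_measure, integral_smul_measure, ENNReal.toReal_ofReal ha,
    ENNReal.toReal_ofReal hb]
  rfl

theorem mem_range_momentsOf_of_mem_extremePoints {m : (Fin d → ℕ) → ℝ}
    (hm : m ∈ (simplexMoments d).extremePoints ℝ) : m ∈ Set.range (momentsOf (d := d)) := by
  let x : stdSimplex ℝ (Fin d) := ⟨fun j => m (Pi.single j 1), fun j => hm.1.1 _, by
    simpa [hm.1.2.1] using hm.1.2.2 0⟩
  refine ⟨⟨Measure.dirac x, inferInstance⟩, ?_⟩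
  funext β
  change ∫ y : stdSimplex ℝ (Fin d), ∏ j, y.1 j ^ β j ∂(Measure.dirac x) = m β
  rw [integral_dirac]
  induction β using multiIndex_induction with
  | zero => simp [hm.1.2.1]
  | step β j ih =>
    rw [prod_pow_add_single, ih, apply_add_single_of_mem_extremePoints hm]

/-- The Hausdorff moment problem on the standard simplex. By the Krein-Milman theorem it suffices
to represent the extreme moment families, and these are the moments of Dirac measures. -/
theorem exists_measure_of_mem_simplexMoments {m : (Fin d → ℕ) → ℝ} (hm : m ∈ simplexMoments d) :
    ∃ ν : ProbabilityMeasure (stdSimplex ℝ (Fin d)), momentsOf ν = m := by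
  have hclosed : IsClosed (Set.range (momentsOf (d := d))) :=
    (isCompact_range continuous_momentsOf).isClosed
  rw [← closure_convexHull_extremePoints isCompact_simplexMoments convex_simplexMoments] at hm
  exact closure_minimal (convexHull_min (fun _ => mem_range_momentsOf_of_mem_extremePoints)
    convex_range_momentsOf) hclosed hm

end Moments

/-! ### Reinhardt measures -/

section Reinhardt

variable {d : ℕ}

/-- The coordinatewise action of `ζ ∈ ℂ^d` on `ℂ^d`. -/
noncomputable def coordMul (ζ : Fin d → ℂ) (z : EuclideanSpace ℂ (Fin d)) : EuclideanSpace ℂ (Fin d) :=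
  WithLp.toLp 2 fun j => ζ j * z j

theorem continuous_coordMul (ζ : Fin d → ℂ) : Continuous (coordMul ζ) := by
  unfold coordMul
  fun_prop

theorem coordMul_coordMul (ζ ξ : Fin d → ℂ) (z : EuclideanSpace ℂ (Fin d)) :
    coordMul ζ (coordMul ξ z) = coordMul (ζ * ξ) z := by
  ext j
  simp [coordMul, mul_assoc]

theorem coordMul_one (z : EuclideanSpace ℂ (Fin d)) : coordMul 1 z = z := by
  ext j
  simp [coordMul]

theorem norm_coordMul {ζ : Fin d → ℂ} (hζ : ∀ j, ‖ζ j‖ = 1) (z : EuclideanSpace ℂ (Fin d)) :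
    ‖coordMul ζ z‖ = ‖z‖ := by
  simp [EuclideanSpace.norm_eq, coordMul, hζ]

theorem inv_mul_torus {ζ : Fin d → ℂ} (hζ : ∀ j, ‖ζ j‖ = 1) : ζ⁻¹ * ζ = 1 := by
  funext j
  have : ζ j ≠ 0 := fun h => by simpa [h] using hζ j
  simp [this]

theorem image_coordMul {ζ : Fin d → ℂ} (hζ : ∀ j, ‖ζ j‖ = 1)
    (Δ : Set (EuclideanSpace ℂ (Fin d))) : coordMul ζ '' Δ = coordMul ζ⁻¹ ⁻¹' Δ := by
  refine congrFun (Set.image_eq_preimage_of_inverse (fun z => ?_) fun z => ?_) Δ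
  · rw [coordMul_coordMul, inv_mul_torus hζ, coordMul_one]
  · rw [coordMul_coordMul, mul_comm, inv_mul_torus hζ, coordMul_one]

/-- The point of the unit sphere with squared moduli `x` and arguments `t`. -/
noncomputable def spherePoint (p : stdSimplex ℝ (Fin d) × (Fin d → UnitAddCircle)) :
    EuclideanSpace ℂ (Fin d) :=
  WithLp.toLp 2 fun j => (AddCircle.toCircle (p.2 j) : ℂ) * (Real.sqrt (p.1.1 j) : ℂ)

theorem continuous_spherePoint : Continuous (spherePoint (d := d)) := by
  unfold spherePoint
  refine (PiLp.continuous_toLp 2 _).comp (continuous_pi fun j => ?_)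
  refine Continuous.mul ?_ ?_
  · exact continuous_subtype_val.comp (AddCircle.continuous_toCircle.comp
      ((continuous_apply j).comp continuous_snd))
  · exact Complex.continuous_ofReal.comp (Real.continuous_sqrt.comp
      ((continuous_apply j).comp (continuous_subtype_val.comp continuous_fst)))

theorem norm_sq_spherePoint_apply (p : stdSimplex ℝ (Fin d) × (Fin d → UnitAddCircle))
    (j : Fin d) : ‖spherePoint p j‖ ^ 2 = p.1.1 j := by
  simp [spherePoint, Circle.norm_coe, abs_of_nonneg (Real.sqrt_nonneg _),
    Real.sq_sqrt (p.1.2.1 j)]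

theorem spherePoint_mem_sphere (p : stdSimplex ℝ (Fin d) × (Fin d → UnitAddCircle)) :
    spherePoint p ∈ Metric.sphere (0 : EuclideanSpace ℂ (Fin d)) 1 := by
  rw [mem_sphere_zero_iff_norm, EuclideanSpace.norm_eq]
  simp_rw [norm_sq_spherePoint_apply]
  rw [p.1.2.2, Real.sqrt_one]

/-- The Haar probability measure of the torus. -/
noncomputable def torusHaar (d : ℕ) : Measure (Fin d → UnitAddCircle) :=
  Measure.pi fun _ => AddCircle.haarAddCircle

instance : IsProbabilityMeasure (torusHaar d) := by unfold torusHaar; infer_instance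

instance : Measure.IsAddLeftInvariant (torusHaar d) := by unfold torusHaar; infer_instance

/-- The Reinhardt measure whose squared moduli are distributed according to `ν`. -/
noncomputable def reinhardtOf (ν : ProbabilityMeasure (stdSimplex ℝ (Fin d))) :
    Measure (EuclideanSpace ℂ (Fin d)) :=
  ((ν : Measure (stdSimplex ℝ (Fin d))).prod (torusHaar d)).map spherePoint

theorem isReinhardt_reinhardtOf (ν : ProbabilityMeasure (stdSimplex ℝ (Fin d))) :
    IsReinhardt (reinhardtOf ν) where
  prob := Measure.isProbabilityMeasure_map continuous_spherePoint.measurable.aemeasurable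
  sphere := by
    rw [reinhardtOf, Measure.map_apply continuous_spherePoint.measurable
      Metric.isClosed_sphere.measurableSet.compl]
    convert measure_empty (μ := (ν : Measure (stdSimplex ℝ (Fin d))).prod (torusHaar d))
    ext p
    simpa using spherePoint_mem_sphere p
  invariant ζ hζ Δ _ hΔ := by
    change reinhardtOf ν (coordMul ζ '' Δ) = _
    have hs : ∀ j, ∃ s : UnitAddCircle, (AddCircle.toCircle s : ℂ) = (ζ j)⁻¹ := by
      intro j
      obtain ⟨s, hs⟩ := (AddCircle.homeomorphCircle (T := 1) one_ne_zero).surjective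
        ⟨(ζ j)⁻¹, mem_sphere_zero_iff_norm.2 (by simp [hζ j])⟩
      rw [AddCircle.homeomorphCircle_apply] at hs
      exact ⟨s, congrArg Subtype.val hs⟩
    choose s hs using hs
    rw [image_coordMul hζ, reinhardtOf, Measure.map_apply continuous_spherePoint.measurable hΔ,
      Measure.map_apply continuous_spherePoint.measurable
        ((continuous_coordMul _).measurable hΔ)]
    have hmp : MeasurePreserving (Prod.map id (s + ·))
        ((ν : Measure (stdSimplex ℝ (Fin d))).prod (torusHaar d))
        ((ν : Measure (stdSimplex ℝ (Fin d))).prod (torusHaar d)) :=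
      (MeasurePreserving.id _).prod (measurePreserving_add_left (torusHaar d) s)
    rw [← hmp.measure_preimage (continuous_spherePoint.measurable hΔ).nullMeasurableSet]
    congr 1
    ext p
    have : coordMul ζ⁻¹ (spherePoint p) = spherePoint (Prod.map id (s + ·) p) := by
      ext j
      simp [coordMul, spherePoint, AddCircle.toCircle_add, hs, mul_assoc]
    simp [this]

theorem IsReinhardt.ae_mem_sphere {μ : Measure (EuclideanSpace ℂ (Fin d))}
    (hμ : IsReinhardt μ) : ∀ᵐ z ∂μ, z ∈ Metric.sphere (0 : EuclideanSpace ℂ (Fin d)) 1 :=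
  hμ.sphere

theorem IsReinhardt.restrict_sphere {μ : Measure (EuclideanSpace ℂ (Fin d))}
    (hμ : IsReinhardt μ) : μ.restrict (Metric.sphere 0 1) = μ :=
  Measure.restrict_eq_self_of_ae_mem hμ.ae_mem_sphere

theorem integral_monomial_reinhardtOf (ν : ProbabilityMeasure (stdSimplex ℝ (Fin d)))
    (β : Fin d → ℕ) :
    ∫ z, ‖∏ j, z j ^ β j‖ ^ 2 ∂(reinhardtOf ν) = momentsOf ν β := by
  rw [reinhardtOf, integral_map continuous_spherePoint.measurable.aemeasurable]
  · have : ∀ p : stdSimplex ℝ (Fin d) × (Fin d → UnitAddCircle),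
        ‖∏ j, spherePoint p j ^ β j‖ ^ 2 = ∏ j, p.1.1 j ^ β j := by
      intro p
      simp only [norm_prod, norm_pow, ← Finset.prod_pow, ← norm_sq_spherePoint_apply, ← pow_mul,
        mul_comm]
    simp_rw [this]
    rw [integral_fun_fst (fun x : stdSimplex ℝ (Fin d) => ∏ j, x.1 j ^ β j)]
    simp [momentsOf]
  · exact Continuous.aestronglyMeasurable (by fun_prop)

theorem IsReinhardt.integral_comp_coordMul {μ : Measure (EuclideanSpace ℂ (Fin d))}
    (hμ : IsReinhardt μ) {ζ : Fin d → ℂ} (hζ : ∀ j, ‖ζ j‖ = 1)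
    (F : EuclideanSpace ℂ (Fin d) → ℂ) : ∫ z, F (coordMul ζ z) ∂μ = ∫ z, F z ∂μ := by
  have hsph : MeasurableSet (Metric.sphere (0 : EuclideanSpace ℂ (Fin d)) 1) :=
    Metric.isClosed_sphere.measurableSet
  have hζ' : ∀ j, ‖ζ⁻¹ j‖ = 1 := fun j => by simp [hζ j]
  have hinv : ζ⁻¹⁻¹ = ζ := inv_inv ζ
  have hmap : μ.map (coordMul ζ) = μ := by
    ext Δ hΔ
    rw [Measure.map_apply (continuous_coordMul ζ).measurable hΔ]
    have hΔ' : MeasurableSet (Δ ∩ Metric.sphere 0 1) := hΔ.inter hsph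
    have h1 : μ (coordMul ζ⁻¹ '' (Δ ∩ Metric.sphere 0 1)) = μ (Δ ∩ Metric.sphere 0 1) :=
      hμ.invariant ζ⁻¹ hζ' _ Set.inter_subset_right hΔ'
    have h2 : coordMul ζ ⁻¹' (Δ ∩ Metric.sphere 0 1) =
        coordMul ζ ⁻¹' Δ ∩ Metric.sphere 0 1 := by
      ext z
      simp [norm_coordMul hζ]
    rw [image_coordMul hζ', hinv, h2] at h1
    rw [measure_inter_conull hμ.sphere, measure_inter_conull hμ.sphere] at h1
    exact h1
  have hemb : MeasurableEmbedding (coordMul ζ) :=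
    (Homeomorph.measurableEmbedding
      { toFun := coordMul ζ
        invFun := coordMul ζ⁻¹
        left_inv := fun z => by rw [coordMul_coordMul, inv_mul_torus hζ, coordMul_one]
        right_inv := fun z => by
          rw [coordMul_coordMul, mul_comm, inv_mul_torus hζ, coordMul_one]
        continuous_toFun := continuous_coordMul ζ
        continuous_invFun := continuous_coordMul ζ⁻¹ })
  conv_rhs => rw [← hmap, hemb.integral_map]

/-- Distinct monomials are orthogonal with respect to a Reinhardt measure: rotating a coordinate
in which the exponents differ by a suitable angle changes the sign of the integrand. -/
theorem IsReinhardt.integral_monomial_mul_conj {μ : Measure (EuclideanSpace ℂ (Fin d))}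
    (hμ : IsReinhardt μ) {β γ : Fin d → ℕ} (hne : β ≠ γ) :
    ∫ z, (starRingEnd ℂ) (∏ j, z j ^ β j) * ∏ j, z j ^ γ j ∂μ = 0 := by
  obtain ⟨i, hi⟩ := Function.ne_iff.1 hne
  have hi' : (γ i : ℝ) - β i ≠ 0 := by
    rw [sub_ne_zero]; exact_mod_cast hi.symm
  set θ : ℝ := Real.pi / ((γ i : ℝ) - β i) with hθ
  set ω : ℂ := Complex.exp (θ * Complex.I) with hω
  have hωn : ‖ω‖ = 1 := Complex.norm_exp_ofReal_mul_I θ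
  have hωω : (starRingEnd ℂ) (ω ^ β i) * ω ^ γ i = -1 := by
    rw [map_pow, hω, ← Complex.exp_conj, ← Complex.exp_nat_mul, ← Complex.exp_nat_mul,
      ← Complex.exp_add, ← Complex.exp_pi_mul_I]
    congr 1
    simp only [map_mul, Complex.conj_ofReal, Complex.conj_I]
    have : (θ : ℂ) * ((γ i : ℂ) - β i) = Real.pi := by
      rw [hθ]
      have h : ((γ i : ℂ) - β i) ≠ 0 := by exact_mod_cast hi'
      push_cast
      field_simp
    linear_combination Complex.I * this
  set ζ : Fin d → ℂ := Function.update 1 i ω with hζdef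
  have hζ : ∀ j, ‖ζ j‖ = 1 := by
    intro j
    by_cases h : j = i
    · subst h; simp [hζdef, hωn]
    · simp [hζdef, h]
  have hprod : ∀ δ : Fin d → ℕ, ∀ z : EuclideanSpace ℂ (Fin d),
      ∏ j, coordMul ζ z j ^ δ j = ω ^ δ i * ∏ j, z j ^ δ j := by
    intro δ z
    simp only [coordMul, mul_pow, Finset.prod_mul_distrib]
    congr 1
    rw [Finset.prod_eq_single i]
    · simp [hζdef]
    · intro j _ hj
      simp [hζdef, hj]
    · simp
  have h := hμ.integral_comp_coordMul hζ
    (fun z => (starRingEnd ℂ) (∏ j, z j ^ β j) * ∏ j, z j ^ γ j)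
  simp only [hprod] at h
  have h2 : ∀ z : EuclideanSpace ℂ (Fin d),
      (starRingEnd ℂ) (ω ^ β i * ∏ j, z j ^ β j) * (ω ^ γ i * ∏ j, z j ^ γ j) =
      -1 * ((starRingEnd ℂ) (∏ j, z j ^ β j) * ∏ j, z j ^ γ j) := by
    intro z
    rw [← hωω, map_mul]
    ring
  simp only [h2] at h
  rw [integral_const_mul] at h
  linear_combination (-1 / 2 : ℂ) * h

theorem IsReinhardt.integrable_of_continuous {E : Type*} [NormedAddCommGroup E]
    {μ : Measure (EuclideanSpace ℂ (Fin d))}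
    (hμ : IsReinhardt μ) {F : EuclideanSpace ℂ (Fin d) → E} (hF : Continuous F) :
    Integrable F μ := by
  have := hμ.prob
  rw [← hμ.restrict_sphere]
  exact hF.continuousOn.integrableOn_compact (isCompact_sphere 0 1)

/-- The second moments of a Reinhardt measure of order one add up to the total mass. -/
theorem IsReinhardt.sum_integral_norm_sq {μ : Measure (EuclideanSpace ℂ (Fin d))}
    (hμ : IsReinhardt μ) : ∑ j, ∫ z, ‖z j‖ ^ 2 ∂μ = 1 := by
  have := hμ.prob
  rw [← integral_finsetSum _ fun j _ => hμ.integrable_of_continuous (by fun_prop)]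
  have h : (fun z : EuclideanSpace ℂ (Fin d) => ∑ j, ‖z j‖ ^ 2) =ᵐ[μ] fun _ => (1 : ℝ) := by
    filter_upwards [hμ.ae_mem_sphere] with z hz
    rw [mem_sphere_zero_iff_norm] at hz
    rw [← EuclideanSpace.norm_sq_eq, hz, one_pow]
  rw [integral_congr_ae h]
  simp

end Reinhardt

/-! ### Powers of commuting tuples and the integral representation -/

section Tuple

variable {d : ℕ} {H K : Type*} [NormedAddCommGroup H] [InnerProductSpace ℂ H]
  [NormedAddCommGroup K] [InnerProductSpace ℂ K]

theorem tuplePow_zero (S : Fin d → H →L[ℂ] H) : tuplePow S 0 = 1 := by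
  simp [tuplePow]

open scoped IsMulCommutative in
theorem tuplePow_add_single {S : Fin d → H →L[ℂ] H} (hS : ∀ i j, Commute (S i) (S j))
    (β : Fin d → ℕ) (j : Fin d) :
    tuplePow S (β + Pi.single j 1) = S j * tuplePow S β := by
  -- the computation takes place in the commutative monoid generated by the tuple
  have : IsMulCommutative (Submonoid.closure (Set.range S)) :=
    Submonoid.isMulCommutative_closure _ (by
      rintro _ ⟨i, rfl⟩ _ ⟨k, rfl⟩
      exact hS i k)
  let s : Fin d → Submonoid.closure (Set.range S) :=
    fun i => ⟨S i, Submonoid.subset_closure ⟨i, rfl⟩⟩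
  have key : ∀ γ : Fin d → ℕ, tuplePow S γ =
      (Submonoid.closure (Set.range S)).subtype (∏ i, s i ^ γ i) := by
    intro γ
    rw [← List.prod_ofFn, map_list_prod, List.map_ofFn]
    rfl
  rw [key, key, prod_pow_add_single, mul_comm, map_mul]
  rfl

theorem tuplePow_single {S : Fin d → H →L[ℂ] H} (hS : ∀ i j, Commute (S i) (S j)) (j : Fin d) :
    tuplePow S (Pi.single j 1) = S j := by
  have := tuplePow_add_single hS 0 j
  rwa [zero_add, tuplePow_zero, mul_one] at this

variable [CompleteSpace H]

theorem norm_sq_polySum {S : Fin d → H →L[ℂ] H} {x : H}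
    (hx : ∀ β γ, β ≠ γ → inner ℂ (tuplePow S β x) (tuplePow S γ x) = 0)
    (a : (Fin d → ℕ) → ℂ) (k : ℕ) :
    ‖polySum S x a k‖ ^ 2 = ∑ β ∈ multiIndex d k, ‖a β‖ ^ 2 * ‖tuplePow S β x‖ ^ 2 := by
  rw [polySum, norm_sq_sum_of_pairwise_orthogonal]
  · simp only [norm_smul, mul_pow]
  · intro β γ h
    rw [inner_smul_left, inner_smul_right, hx β γ h, mul_zero, mul_zero]

theorem IsReinhardt.integral_norm_sq_polySumAt {μ : Measure (EuclideanSpace ℂ (Fin d))}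
    (hμ : IsReinhardt μ) (R : K →L[ℂ] K) (y : K) (a : (Fin d → ℕ) → ℂ) (k : ℕ) :
    ∫ z, ‖polySumAt R y a k z‖ ^ 2 ∂μ = ∑ β ∈ multiIndex d k,
      ‖a β‖ ^ 2 * (‖(R ^ (∑ j, β j)) y‖ ^ 2 * ∫ z, ‖∏ j, z j ^ β j‖ ^ 2 ∂μ) := by
  have hcont : ∀ β : Fin d → ℕ,
      Continuous fun z : EuclideanSpace ℂ (Fin d) => ∏ j, z j ^ β j := fun β => by fun_prop
  have hself : ∀ x : K, ((‖x‖ ^ 2 : ℝ) : ℂ) = inner ℂ x x := fun x => by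
    rw [inner_self_eq_norm_sq_to_K]; push_cast; rfl
  -- expansion of the squared norm into products of monomials
  have hexp : ∀ z, ((‖polySumAt R y a k z‖ ^ 2 : ℝ) : ℂ) =
      ∑ β ∈ multiIndex d k, ∑ γ ∈ multiIndex d k,
        ((starRingEnd ℂ (a β) * a γ * inner ℂ ((R ^ (∑ j, β j)) y) ((R ^ (∑ j, γ j)) y)) *
          (starRingEnd ℂ (∏ j, z j ^ β j) * ∏ j, z j ^ γ j)) := by
    intro z
    rw [hself, polySumAt, sum_inner]
    refine Finset.sum_congr rfl fun β _ => ?_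
    rw [inner_sum]
    refine Finset.sum_congr rfl fun γ _ => ?_
    rw [inner_smul_left, inner_smul_right, map_mul]
    ring
  have hcast : ((∫ z, ‖polySumAt R y a k z‖ ^ 2 ∂μ : ℝ) : ℂ) = ((∑ β ∈ multiIndex d k,
      ‖a β‖ ^ 2 * (‖(R ^ (∑ j, β j)) y‖ ^ 2 * ∫ z, ‖∏ j, z j ^ β j‖ ^ 2 ∂μ) : ℝ) : ℂ) := by
    rw [← integral_complex_ofReal]
    simp_rw [hexp]
    have hint : ∀ β γ : Fin d → ℕ, ∀ C : ℂ, Integrable (fun z : EuclideanSpace ℂ (Fin d) =>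
        C * (starRingEnd ℂ (∏ j, z j ^ β j) * ∏ j, z j ^ γ j)) μ := fun β γ C =>
      hμ.integrable_of_continuous
        (continuous_const.mul ((Complex.continuous_conj.comp (hcont β)).mul (hcont γ)))
    rw [integral_finsetSum _ fun β _ => integrable_finsetSum _ fun γ _ => hint β γ _,
      Complex.ofReal_sum]
    refine Finset.sum_congr rfl fun β hβ => ?_
    rw [integral_finsetSum _ fun γ _ => hint β γ _, Finset.sum_eq_single β]
    · rw [integral_const_mul, ← hself]
      have : ∀ z : EuclideanSpace ℂ (Fin d), starRingEnd ℂ (∏ j, z j ^ β j) * ∏ j, z j ^ β j =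
          ((‖∏ j, z j ^ β j‖ ^ 2 : ℝ) : ℂ) := fun z => by
        rw [Complex.conj_mul']; push_cast; rfl
      simp_rw [this]
      rw [integral_complex_ofReal, Complex.conj_mul']
      push_cast
      ring
    · intro γ _ hγ
      rw [integral_const_mul, hμ.integral_monomial_mul_conj hγ.symm, mul_zero]
    · exact fun h => (h hβ).elim
  exact_mod_cast hcast

/-- The integral representation amounts to an identity between the moments of `μ` and the norms
`‖S^β x‖`, because monomials are orthogonal on both sides. -/
theorem IsReinhardt.integralRep_iff {μ : Measure (EuclideanSpace ℂ (Fin d))}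
    (hμ : IsReinhardt μ) {S : Fin d → H →L[ℂ] H} {x : H}
    (hx : ∀ β γ, β ≠ γ → inner ℂ (tuplePow S β x) (tuplePow S γ x) = 0)
    (R : K →L[ℂ] K) (y : K) :
    IntegralRep S x R y μ ↔ ∀ β : Fin d → ℕ, ‖tuplePow S β x‖ ^ 2 =
      ‖(R ^ (∑ j, β j)) y‖ ^ 2 * ∫ z, ‖∏ j, z j ^ β j‖ ^ 2 ∂μ := by
  classical
  unfold IntegralRep
  simp_rw [hμ.restrict_sphere, hμ.integral_norm_sq_polySumAt, norm_sq_polySum hx]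
  refine ⟨fun h β => ?_, fun h a k => ?_⟩
  · have := h (Pi.single β 1) (∑ j, β j)
    rw [Finset.sum_eq_single β, Finset.sum_eq_single β] at this
    · simpa using this
    · intro γ _ hγ
      simp [hγ]
    · exact fun h => (h ((mem_multiIndex β).2 le_rfl)).elim
    · intro γ _ hγ
      simp [hγ]
    · exact fun h => (h ((mem_multiIndex β).2 le_rfl)).elim
  · exact Finset.sum_congr rfl fun β _ => by rw [h β]

/-- The homogeneous part of degree `n` of the polynomial with coefficients `a`. -/
noncomputable def homPart (a : (Fin d → ℕ) → ℂ) (n : ℕ) (z : EuclideanSpace ℂ (Fin d)) : ℂ :=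
  ∑ β ∈ multiIndex d n with ∑ j, β j = n, a β * ∏ j, z j ^ β j

theorem polySumAt_eq_sum_homPart (R : K →L[ℂ] K) (y : K) (a : (Fin d → ℕ) → ℂ) (k : ℕ)
    (z : EuclideanSpace ℂ (Fin d)) :
    polySumAt R y a k z = ∑ n ∈ Finset.range (k + 1), homPart a n z • (R ^ n) y := by
  rw [polySumAt, ← Finset.sum_fiberwise_of_maps_to (t := Finset.range (k + 1))
    (g := fun β : Fin d → ℕ => ∑ j, β j)
    fun β hβ => Finset.mem_range.2 (Nat.lt_succ_of_le ((mem_multiIndex β).1 hβ))]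
  refine Finset.sum_congr rfl fun n hn => ?_
  have hset : ({β ∈ multiIndex d k | ∑ j, β j = n} : Finset (Fin d → ℕ)) =
      {β ∈ multiIndex d n | ∑ j, β j = n} := by
    ext β
    simp only [Finset.mem_filter, mem_multiIndex]
    have := Finset.mem_range.1 hn
    omega
  rw [hset, homPart, Finset.sum_smul]
  refine Finset.sum_congr rfl fun β hβ => ?_
  rw [(Finset.mem_filter.1 hβ).2]

theorem summable_of_pairwise_orthogonal [CompleteSpace K] {x : ℕ → K}
    (hx : ∀ m n, m ≠ n → inner ℂ (x m) (x n) = 0) (hs : Summable fun n => ‖x n‖ ^ 2) :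
    Summable x := by
  have hV : OrthogonalFamily ℂ (fun n => (ℂ ∙ x n : Submodule ℂ K))
      fun n => (ℂ ∙ x n : Submodule ℂ K).subtypeₗᵢ := by
    refine OrthogonalFamily.of_pairwise fun m n hmn => ?_
    exact Submodule.isOrtho_span.2 fun u hu v hv => by
      rw [Set.mem_singleton_iff.1 hu, Set.mem_singleton_iff.1 hv, hx m n hmn]
  exact (hV.summable_iff_norm_sq_summable
    fun n => ⟨x n, Submodule.mem_span_singleton_self _⟩).2 hs

/-- Passage to the limit in the integral representation: the squared norms of the homogeneous
parts have a finite sum almost everywhere by monotone convergence, and orthogonal series with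
this property converge. -/
theorem IntegralRep.exists_limit [CompleteSpace K] {μ : Measure (EuclideanSpace ℂ (Fin d))}
    (hμ : IsReinhardt μ) {S : Fin d → H →L[ℂ] H} {x : H} {R : K →L[ℂ] K} {y : K}
    (hrep : IntegralRep S x R y μ) (hy : ∀ m n, m ≠ n → inner ℂ ((R ^ m) y) ((R ^ n) y) = 0)
    {a : (Fin d → ℕ) → ℂ} {f : H} (hf : Tendsto (fun k => polySum S x a k) atTop (𝓝 f)) :
    ∃ F : EuclideanSpace ℂ (Fin d) → K,
      (∀ᵐ z ∂μ, Tendsto (fun k => polySumAt R y a k z) atTop (𝓝 (F z))) ∧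
      IntegrableOn (fun z => ‖F z‖ ^ 2) (Metric.sphere 0 1) μ ∧
      ‖f‖ ^ 2 = ∫ z in Metric.sphere 0 1, ‖F z‖ ^ 2 ∂μ := by
  have hq : ∀ n, Continuous (homPart (d := d) a n) := fun n => by
    unfold homPart
    fun_prop
  set u : ℕ → EuclideanSpace ℂ (Fin d) → ℝ := fun n z => ‖homPart a n z • (R ^ n) y‖ ^ 2 with hu
  have hu0 : ∀ n z, 0 ≤ u n z := fun n z => sq_nonneg _
  have huc : ∀ n, Continuous (u n) := fun n => (((hq n).smul continuous_const).norm.pow 2)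
  have hui : ∀ n, Integrable (u n) μ := fun n => hμ.integrable_of_continuous (huc n)
  have horth : ∀ z m n, m ≠ n →
      inner ℂ (homPart a m z • (R ^ m) y) (homPart a n z • (R ^ n) y) = 0 := by
    intro z m n hmn
    rw [inner_smul_left, inner_smul_right, hy m n hmn, mul_zero, mul_zero]
  have hnorm : ∀ k z, ‖polySumAt R y a k z‖ ^ 2 = ∑ n ∈ Finset.range (k + 1), u n z := by
    intro k z
    rw [polySumAt_eq_sum_homPart, norm_sq_sum_of_pairwise_orthogonal _ _ (horth z)]
  have hsum : HasSum (fun n => ∫ z, u n z ∂μ) (‖f‖ ^ 2) := by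
    rw [hasSum_iff_tendsto_nat_of_nonneg fun n => integral_nonneg (hu0 n),
      ← tendsto_add_atTop_iff_nat 1]
    refine Tendsto.congr (fun k => ?_) (hf.norm.pow 2)
    rw [hrep a k, hμ.restrict_sphere, ← integral_finsetSum _ fun n _ => hui n]
    simp_rw [hnorm]
  set G : EuclideanSpace ℂ (Fin d) → ENNReal := fun z => ∑' n, ENNReal.ofReal (u n z) with hG
  have hGm : Measurable G := Measurable.tsum fun n => (huc n).measurable.ennreal_ofReal
  have hGint : ∫⁻ z, G z ∂μ = ENNReal.ofReal (‖f‖ ^ 2) := by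
    rw [hG, lintegral_tsum fun n => (huc n).measurable.ennreal_ofReal.aemeasurable, ← hsum.tsum_eq,
      ENNReal.ofReal_tsum_of_nonneg (fun n => integral_nonneg (hu0 n)) hsum.summable]
    exact tsum_congr fun n =>
      (ofReal_integral_eq_lintegral_ofReal (hui n) (Eventually.of_forall (hu0 n))).symm
  have hGfin : ∀ᵐ z ∂μ, G z < ⊤ := ae_lt_top hGm (by rw [hGint]; exact ENNReal.ofReal_ne_top)
  have hsummable : ∀ z, G z < ⊤ → Summable fun n => u n z := by
    intro z hz
    refine (ENNReal.summable_toReal hz.ne).congr fun n => ?_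
    rw [ENNReal.toReal_ofReal (hu0 n z)]
  have hlim : ∀ z, G z < ⊤ → Tendsto (fun k => polySumAt R y a k z) atTop
      (𝓝 (∑' n, homPart a n z • (R ^ n) y)) := by
    intro z hz
    have h := (summable_of_pairwise_orthogonal (horth z) (hsummable z hz)).hasSum
    simp_rw [polySumAt_eq_sum_homPart]
    exact h.tendsto_sum_nat.comp (tendsto_add_atTop_nat 1)
  have hFG : (fun z => ‖∑' n, homPart a n z • (R ^ n) y‖ ^ 2) =ᵐ[μ] fun z => (G z).toReal := by
    filter_upwards [hGfin] with z hz
    have h1 := (hlim z hz).norm.pow 2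
    simp_rw [hnorm] at h1
    have h2 := (hsummable z hz).hasSum.tendsto_sum_nat.comp (tendsto_add_atTop_nat 1)
    change _ = (∑' n, ENNReal.ofReal (u n z)).toReal
    rw [tendsto_nhds_unique h1 h2, ← ENNReal.ofReal_tsum_of_nonneg (fun n => hu0 n z)
      (hsummable z hz), ENNReal.toReal_ofReal (tsum_nonneg fun n => hu0 n z)]
  refine ⟨fun z => ∑' n, homPart a n z • (R ^ n) y, ?_, ?_, ?_⟩
  · filter_upwards [hGfin] with z hz using hlim z hz
  · rw [IntegrableOn, hμ.restrict_sphere]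
    exact (integrable_toReal_of_lintegral_ne_top hGm.aemeasurable
      (by rw [hGint]; exact ENNReal.ofReal_ne_top)).congr hFG.symm
  · rw [hμ.restrict_sphere, integral_congr_ae hFG, integral_toReal hGm.aemeasurable hGfin, hGint,
      ENNReal.toReal_ofReal (sq_nonneg _)]

end Tuple

/-! ### Multishifts as graded shifts -/

section Multishift

variable {d : ℕ} {V : Fin d → Type*} {T : ∀ j, RootedDirectedTree (V j)}
  {lam : Fin d → (∀ j, V j) → ℝ} {S : Fin d → L2 (∀ j, V j) →L[ℂ] L2 (∀ j, V j)}

theorem IsMultishift.exists_of_apply_e_ne_zero (hS : IsMultishift T lam S) {j : Fin d}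
    {v w : ∀ j, V j} (hw : S j (e v) w ≠ 0) :
    ∃ u, (T j).Adj u (w j) ∧ Function.update w j u = v := by
  rcases (T j).eq_root_or_exists_parent (w j) with h | ⟨u, hu⟩
  · exact (hw ((hS j (e v) w).2 h)).elim
  · refine ⟨u, hu, ?_⟩
    by_contra hne
    exact hw (by rw [(hS j (e v) w).1 u hu, e_apply_ne hne, mul_zero])

theorem IsMultishift.depthVec_eq (hS : IsMultishift T lam S) (j : Fin d) (v w : ∀ j, V j)
    (hw : S j (e v) w ≠ 0) : depthVec T w = depthVec T v + Pi.single j 1 := by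
  obtain ⟨u, hu, rfl⟩ := hS.exists_of_apply_e_ne_zero hw
  funext i
  by_cases hi : i = j
  · subst hi
    simp [depthVec, (T i).depth_adj hu]
  · simp [depthVec, hi]

theorem IsMultishift.isGradedShift (hS : IsMultishift T lam S) :
    IsGradedShift (fun v => ∑ j, depthVec T v j) S where
  level j v w hw := by
    have h1 : ∑ i, (Pi.single j 1 : Fin d → ℕ) i = 1 := by simp
    simp only [hS.depthVec_eq j v w hw, Pi.add_apply, Finset.sum_add_distrib, h1]
  disjoint j v v' w hv hv' := by
    obtain ⟨u, hu, rfl⟩ := hS.exists_of_apply_e_ne_zero hv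
    obtain ⟨u', hu', rfl⟩ := hS.exists_of_apply_e_ne_zero hv'
    rw [(T j).parent_unique hu hu']

theorem IsMultishift.tuplePow_level (hS : IsMultishift T lam S)
    (hcomm : ∀ i j, Commute (S i) (S j)) (v : ∀ j, V j) (β : Fin d → ℕ) (w : ∀ j, V j)
    (hw : tuplePow S β (e v) w ≠ 0) : depthVec T w = depthVec T v + β := by
  induction β using multiIndex_induction generalizing w with
  | zero =>
    by_contra hne
    rw [tuplePow_zero] at hw
    exact hw (e_apply_ne fun h => hne (by simp [h]))
  | step β j ih =>
    rw [tuplePow_add_single hcomm] at hw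
    rw [← add_assoc]
    exact support_apply_of_level (D := depthVec T) ih (hS.depthVec_eq j) w hw

theorem IsMultishift.inner_tuplePow (hS : IsMultishift T lam S)
    (hcomm : ∀ i j, Commute (S i) (S j)) (v : ∀ j, V j) (β γ : Fin d → ℕ) (h : β ≠ γ) :
    inner ℂ (tuplePow S β (e v)) (tuplePow S γ (e v)) = 0 := by
  refine inner_eq_zero_of_disjoint fun w hβ hγ => h ?_
  have := hS.tuplePow_level hcomm v γ w hγ
  rw [hS.tuplePow_level hcomm v β w hβ] at this
  exact add_left_cancel this

/-- If all `A j` vanish at `x`, then so does the invertible operator `Q(I)`, which forces `x = 0`. -/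
theorem JointLeftInvertible.sum_norm_sq_pos {H : Type*} [NormedAddCommGroup H]
    [InnerProductSpace ℂ H] [CompleteSpace H] {A : Fin d → H →L[ℂ] H}
    (hA : JointLeftInvertible A) {x : H} (hx : x ≠ 0) : 0 < ∑ j, ‖A j x‖ ^ 2 := by
  refine (Finset.sum_nonneg fun j _ => sq_nonneg _).lt_of_ne' fun h0 => hx ?_
  have hz : ∀ j, A j x = 0 := fun j => by
    simpa using (Finset.sum_eq_zero_iff_of_nonneg fun j _ => sq_nonneg _).1 h0 j
      (Finset.mem_univ j)
  have hQ : Q A 1 x = 0 := by simp [Q, hz]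
  obtain ⟨B, hB⟩ := hA.2.exists_left_inv
  have : (B * Q A 1) x = x := by rw [hB]; rfl
  rw [← this]
  change B (Q A 1 x) = 0
  rw [hQ, map_zero]

end Multishift

/-! ### Weighted shifts on graphs with unique parents -/

section WeightedShift

theorem exists_isWeightedShift {W : Type*} {G : Digraph W}
    (hG : ∀ ⦃u u' w⦄, G.Adj u w → G.Adj u' w → u = u') {θ : W → ℝ} {C : ℝ}
    (hC : ∀ u (s : Finset W), (∀ w ∈ s, G.Adj u w) → ∑ w ∈ s, θ w ^ 2 ≤ C) :
    ∃ R : L2 W →L[ℂ] L2 W, IsWeightedShift G θ R := by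
  classical
  rcases isEmpty_or_nonempty W with hW | ⟨⟨w₀⟩⟩
  · exact ⟨0, fun _ w => (hW.false w).elim⟩
  have hC0 : 0 ≤ C := by simpa using hC w₀ ∅ (by simp)
  -- the parent, with a weight that vanishes at vertices without parent
  let par : W → W := fun w => if h : ∃ u, G.Adj u w then h.choose else w
  let b : W → ℝ := fun w => if ∃ u, G.Adj u w then θ w else 0
  have hpar : ∀ {u w}, G.Adj u w → par w = u := by
    intro u w h
    have h' : ∃ u, G.Adj u w := ⟨u, h⟩
    simp only [par, dif_pos h']
    exact hG h'.choose_spec h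
  have hb : ∀ u (s : Finset W), (∀ w ∈ s, par w = u) → ∑ w ∈ s, b w ^ 2 ≤ C := by
    intro u s hs
    have : ∑ w ∈ s, b w ^ 2 = ∑ w ∈ s with ∃ u, G.Adj u w, θ w ^ 2 := by
      rw [Finset.sum_filter]
      refine Finset.sum_congr rfl fun w _ => ?_
      simp only [b]
      split_ifs <;> simp
    rw [this]
    refine hC u _ fun w hw => ?_
    obtain ⟨hws, u', hu'⟩ := Finset.mem_filter.1 hw
    rw [← hs w hws, hpar hu']
    exact hu'
  have hbound : ∀ (f : L2 W) (s : Finset W),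
      ∑ w ∈ s, ‖(b w : ℂ) * f (par w)‖ ^ (2 : ENNReal).toReal ≤ C * ‖f‖ ^ 2 := by
    intro f s
    have hf := lp.sum_rpow_le_norm_rpow (p := 2) (by simp) f (s.image par)
    simp only [ENNReal.toReal_ofNat, Real.rpow_ofNat] at hf ⊢
    calc ∑ w ∈ s, ‖(b w : ℂ) * f (par w)‖ ^ 2
        = ∑ u ∈ s.image par, ∑ w ∈ s with par w = u, ‖(b w : ℂ) * f (par w)‖ ^ 2 :=
          (Finset.sum_fiberwise_of_maps_to (fun w hw => Finset.mem_image_of_mem par hw) _).symm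
      _ = ∑ u ∈ s.image par, (∑ w ∈ s with par w = u, b w ^ 2) * ‖f u‖ ^ 2 := by
          refine Finset.sum_congr rfl fun u _ => ?_
          rw [Finset.sum_mul]
          refine Finset.sum_congr rfl fun w hw => ?_
          rw [(Finset.mem_filter.1 hw).2, norm_mul, mul_pow, Complex.norm_real, Real.norm_eq_abs,
            sq_abs]
      _ ≤ ∑ u ∈ s.image par, C * ‖f u‖ ^ 2 := by
          refine Finset.sum_le_sum fun u _ => ?_
          gcongr
          exact hb u _ fun w hw => (Finset.mem_filter.1 hw).2
      _ ≤ C * ‖f‖ ^ 2 := by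
          rw [← Finset.mul_sum]
          gcongr
  let L : L2 W →ₗ[ℂ] L2 W :=
    { toFun := fun f => ⟨fun w => (b w : ℂ) * f (par w), memℓp_gen' (hbound f)⟩
      map_add' := fun f g => by
        ext w
        change (b w : ℂ) * (f (par w) + g (par w)) = _
        rw [mul_add]
        rfl
      map_smul' := fun r f => by
        ext w
        change (b w : ℂ) * (r * f (par w)) = r * ((b w : ℂ) * f (par w))
        ring }
  refine ⟨L.mkContinuous (Real.sqrt C) fun f => ?_, fun f w => ⟨fun u hu => ?_, fun hw => ?_⟩⟩
  · refine lp.norm_le_of_forall_sum_le (by simp) (by positivity) fun s => ?_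
    refine (hbound f s).trans_eq ?_
    simp [mul_pow, Real.sq_sqrt hC0]
  · change (b w : ℂ) * f (par w) = _
    rw [hpar hu]
    simp only [b, if_pos (⟨u, hu⟩ : ∃ u, G.Adj u w)]
  · change (b w : ℂ) * f (par w) = _
    have : ¬ ∃ u, G.Adj u w := fun ⟨u, hu⟩ => hw u hu
    simp [b, this]

theorem IsWeightedShift.adj_of_apply_e_ne_zero {W : Type*} {G : Digraph W} {θ : W → ℝ}
    {R : L2 W →L[ℂ] L2 W} (hR : IsWeightedShift G θ R) {u w : W} (hw : R (e u) w ≠ 0) :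
    G.Adj u w := by
  by_cases h : IsRoot G w
  · exact (hw ((hR _ w).2 h)).elim
  · obtain ⟨u', hu'⟩ : ∃ u', G.Adj u' w := by
      simpa [IsRoot] using h
    rw [(hR _ w).1 u' hu'] at hw
    have : u' = u := by
      by_contra hne
      exact hw (by rw [e_apply_ne hne, mul_zero])
    exact this ▸ hu'

variable {d : ℕ} {V : Fin d → Type*} {T : ∀ j, RootedDirectedTree (V j)}

/-- The squared balanced weights of the children of `u` are all equal and add up to `c` at the
depth of `u`. -/
theorem balancedWeight_sq (hd : 0 < d) {c : ℕ → ℝ} (hc : ∀ t, 0 < c t) {u w : TensorVertex T}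
    (h : (tensorComponent T).Adj u w) :
    balancedWeight T c w ^ 2 =
      c (tensorDepth T u) / ({x | (tensorComponent T).Adj u x}.ncard : ℝ) := by
  rw [balancedWeight, sib_eq_children (tensorComponent_parent_unique T) h,
    tensorDepth_adj T hd h, Nat.add_sub_cancel, div_pow, Real.sq_sqrt (hc _).le,
    Real.sq_sqrt (Nat.cast_nonneg _)]

theorem exists_isBalancedShift (hd : 0 < d) (hfin : ∀ j, (T j).LocallyFinite) {c : ℕ → ℝ}
    (hc : ∀ t, 0 < c t) (hb : BddAbove (Set.range c)) : ∃ R, IsBalancedShift T c R := by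
  obtain ⟨C, hC⟩ := hb
  have hcC : ∀ t, c t ≤ C := fun t => hC ⟨t, rfl⟩
  obtain ⟨R, hR⟩ := exists_isWeightedShift (tensorComponent_parent_unique T)
    (θ := balancedWeight T c) (C := C) (by
      intro u s hs
      rw [Finset.sum_congr rfl fun w hw => balancedWeight_sq hd hc (hs w hw), Finset.sum_const,
        nsmul_eq_mul]
      rcases s.eq_empty_or_nonempty with rfl | hne
      · simpa using (hc 0).le.trans (hcC 0)
      have hcard : s.card ≤ {x | (tensorComponent T).Adj u x}.ncard := by
        rw [← Set.ncard_coe_finset]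
        exact Set.ncard_le_ncard (fun w hw => hs w hw) (tensorComponent_children_finite T hfin u)
      have hpos : 0 < s.card := hne.card_pos
      have hpos' : (0 : ℝ) < ({x | (tensorComponent T).Adj u x}.ncard : ℝ) := by
        exact_mod_cast hpos.trans_le hcard
      calc (s.card : ℝ) * (c (tensorDepth T u) / ({x | (tensorComponent T).Adj u x}.ncard : ℝ))
          ≤ ({x | (tensorComponent T).Adj u x}.ncard : ℝ) *
            (c (tensorDepth T u) / ({x | (tensorComponent T).Adj u x}.ncard : ℝ)) := by
            gcongr
            exact div_nonneg (hc _).le hpos'.le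
        _ = c (tensorDepth T u) := by field_simp
        _ ≤ C := hcC _)
  exact ⟨R, hc, ⟨C, hC⟩, hR⟩

variable {c : ℕ → ℝ} {R : L2 (TensorVertex T) →L[ℂ] L2 (TensorVertex T)}

theorem IsBalancedShift.isGradedShift (hd : 0 < d) (hR : IsBalancedShift T c R) :
    IsGradedShift (tensorDepth T) fun _ : Fin 1 => R where
  level _ _ _ hw := tensorDepth_adj T hd (hR.2.2.adj_of_apply_e_ne_zero hw)
  disjoint _ _ _ _ h h' := tensorComponent_parent_unique T (hR.2.2.adj_of_apply_e_ne_zero h)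
    (hR.2.2.adj_of_apply_e_ne_zero h')

theorem IsBalancedShift.norm_sq_apply_e (hd : 0 < d) (hfin : ∀ j, (T j).LocallyFinite)
    (hleaf : ∀ j, (T j).Leafless) (hR : IsBalancedShift T c R) (u : TensorVertex T) :
    ‖R (e u)‖ ^ 2 = c (tensorDepth T u) := by
  have hF := tensorComponent_children_finite T hfin u
  have hsum : HasSum (fun w => ‖R (e u) w‖ ^ 2) (∑ w ∈ hF.toFinset, ‖R (e u) w‖ ^ 2) := by
    refine hasSum_sum_of_ne_finset_zero fun w hw => ?_
    by_contra h0
    refine hw (hF.mem_toFinset.2 (hR.2.2.adj_of_apply_e_ne_zero fun h => h0 ?_))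
    simp [h]
  rw [(norm_sq_eq_tsum (R (e u))).unique hsum]
  have hterm : ∀ w ∈ hF.toFinset, ‖R (e u) w‖ ^ 2 =
      c (tensorDepth T u) / ({x | (tensorComponent T).Adj u x}.ncard : ℝ) := by
    intro w hw
    have hw' : (tensorComponent T).Adj u w := hF.mem_toFinset.1 hw
    rw [(hR.2.2 _ w).1 u hw', e_apply_self, mul_one, Complex.norm_real, Real.norm_eq_abs, sq_abs,
      balancedWeight_sq hd hR.1 hw']
  rw [Finset.sum_congr rfl hterm, Finset.sum_const, nsmul_eq_mul,
    ← Set.ncard_eq_toFinset_card _ hF]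
  have hne : ({x | (tensorComponent T).Adj u x}.ncard : ℝ) ≠ 0 := by
    have := (Set.ncard_pos hF).2 (tensorComponent_exists_child T hleaf u)
    exact_mod_cast this.ne'
  field_simp

theorem IsBalancedShift.norm_sq_pow_apply_e (hd : 0 < d) (hfin : ∀ j, (T j).LocallyFinite)
    (hleaf : ∀ j, (T j).Leafless) (hR : IsBalancedShift T c R) (n : ℕ) (u : TensorVertex T) :
    ‖(R ^ n) (e u)‖ ^ 2 = ∏ i ∈ Finset.range n, c (tensorDepth T u + i) :=
  (hR.isGradedShift hd).norm_pow_apply_e (hR.norm_sq_apply_e hd hfin hleaf) n u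

theorem IsBalancedShift.inner_pow (hd : 0 < d) (hR : IsBalancedShift T c R) (u : TensorVertex T)
    (m n : ℕ) (h : m ≠ n) : inner ℂ ((R ^ m) (e u)) ((R ^ n) (e u)) = 0 := by
  refine inner_eq_zero_of_disjoint fun w hm hn => h ?_
  have h1 := (hR.isGradedShift hd).pow_level m u w hm
  have h2 := (hR.isGradedShift hd).pow_level n u w hn
  omega

end WeightedShift

/-! ### The two implications and the norm identities -/

section Equivalence

variable {d : ℕ} {V : Fin d → Type*} {T : ∀ j, RootedDirectedTree (V j)}
  {lam : Fin d → (∀ j, V j) → ℝ} {S : Fin d → L2 (∀ j, V j) →L[ℂ] L2 (∀ j, V j)}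
  {p : (∀ j, V j) → TensorVertex T}

theorem SphericallyBalanced.exists_bounded (hd : 0 < d) (hleaf : ∀ j, (T j).Leafless)
    (hinv : JointLeftInvertible S) (hbal : SphericallyBalanced T S) :
    ∃ c : ℕ → ℝ, (∀ t, 0 < c t) ∧ BddAbove (Set.range c) ∧
      ∀ v, ∑ j, ‖S j (e v)‖ ^ 2 = c (∑ j, depthVec T v j) := by
  choose x hx using exists_mem_generation T hd hleaf
  refine ⟨fun t => ∑ j, ‖S j (e (x t))‖ ^ 2, fun t => ?_, ⟨∑ j, ‖S j‖ ^ 2, ?_⟩, fun v => ?_⟩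
  · refine hinv.sum_norm_sq_pos fun h => ?_
    have := norm_e (x t)
    rw [h, norm_zero] at this
    exact zero_ne_one this
  · rintro _ ⟨t, rfl⟩
    refine Finset.sum_le_sum fun j _ => ?_
    gcongr
    simpa [norm_e] using (S j).le_opNorm (e (x t))
  · exact hbal _ v rfl _ (hx _)

/-- The numbers `‖S^β e_v‖² / ∏_{i < |β|} c(|α_v| + i)` are candidate simplex moments; the
compatibility relation is spherical balancedness applied to `S^β e_v`. -/
theorem IsMultishift.mem_simplexMoments (hS : IsMultishift T lam S)
    (hcomm : ∀ i j, Commute (S i) (S j)) {c : ℕ → ℝ} (hc : ∀ t, 0 < c t)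
    (hSc : ∀ v, ∑ j, ‖S j (e v)‖ ^ 2 = c (∑ j, depthVec T v j)) (v : ∀ j, V j) :
    (fun β : Fin d → ℕ => ‖tuplePow S β (e v)‖ ^ 2 /
      ∏ i ∈ Finset.range (∑ j, β j), c ((∑ j, depthVec T v j) + i)) ∈ simplexMoments d := by
  refine ⟨fun β => div_nonneg (sq_nonneg _) (Finset.prod_nonneg fun i _ => (hc _).le), ?_,
    fun β => ?_⟩
  · simp [tuplePow_zero, norm_e]
  · have hsum : ∀ j, ∑ i, (β + Pi.single j 1 : Fin d → ℕ) i = ∑ i, β i + 1 := by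
      intro j
      have h1 : ∑ i, (Pi.single j 1 : Fin d → ℕ) i = 1 := by simp
      simp only [Pi.add_apply, Finset.sum_add_distrib, h1]
    have hlevel : ∀ w, tuplePow S β (e v) w ≠ 0 →
        ∑ j, depthVec T w j = ∑ j, depthVec T v j + ∑ j, β j := by
      intro w hw
      simp only [hS.tuplePow_level hcomm v β w hw, Pi.add_apply, Finset.sum_add_distrib]
    have key := hS.isGradedShift.sum_norm_sq hSc hlevel
    simp only [hsum, tuplePow_add_single hcomm, Finset.prod_range_succ, ← Finset.sum_div]
    change (∑ j, ‖S j (tuplePow S β (e v))‖ ^ 2) / _ = _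
    rw [key]
    have h1 := (hc (∑ j, depthVec T v j + ∑ j, β j)).ne'
    have h2 : ∏ i ∈ Finset.range (∑ j, β j), c ((∑ j, depthVec T v j) + i) ≠ 0 :=
      Finset.prod_ne_zero_iff.2 fun i _ => (hc _).ne'
    field_simp

theorem exists_reinhardt_integralRep (hd : 0 < d) (hfin : ∀ j, (T j).LocallyFinite)
    (hleaf : ∀ j, (T j).Leafless) (hS : IsMultishift T lam S)
    (hcomm : ∀ i j, Commute (S i) (S j))
    (hp : ∀ v, ∑ j, depthVec T v j = tensorDepth T (p v)) {c : ℕ → ℝ}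
    {R : L2 (TensorVertex T) →L[ℂ] L2 (TensorVertex T)} (hR : IsBalancedShift T c R)
    (hSc : ∀ v, ∑ j, ‖S j (e v)‖ ^ 2 = c (∑ j, depthVec T v j)) (v : ∀ j, V j) :
    ∃ μ : Measure (EuclideanSpace ℂ (Fin d)),
      IsReinhardt μ ∧ IntegralRep S (e v) R (e (p v)) μ := by
  obtain ⟨ν, hν⟩ :=
    exists_measure_of_mem_simplexMoments (hS.mem_simplexMoments hcomm hR.1 hSc v)
  have hμ := isReinhardt_reinhardtOf ν
  refine ⟨reinhardtOf ν, hμ, (hμ.integralRep_iff (hS.inner_tuplePow hcomm v) _ _).2 fun β => ?_⟩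
  rw [integral_monomial_reinhardtOf, hν, hR.norm_sq_pow_apply_e hd hfin hleaf, ← hp]
  have : ∏ i ∈ Finset.range (∑ j, β j), c ((∑ j, depthVec T v j) + i) ≠ 0 :=
    Finset.prod_ne_zero_iff.2 fun i _ => (hR.1 _).ne'
  field_simp

/-- The representation in degree one yields spherical balancedness, since the second moments of
a Reinhardt measure add up to one. -/
theorem IntegralRep.sum_norm_sq (hd : 0 < d) (hfin : ∀ j, (T j).LocallyFinite)
    (hleaf : ∀ j, (T j).Leafless) (hS : IsMultishift T lam S)
    (hcomm : ∀ i j, Commute (S i) (S j))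
    (hp : ∀ v, ∑ j, depthVec T v j = tensorDepth T (p v)) {c : ℕ → ℝ}
    {R : L2 (TensorVertex T) →L[ℂ] L2 (TensorVertex T)} (hR : IsBalancedShift T c R)
    {v : ∀ j, V j} {μ : Measure (EuclideanSpace ℂ (Fin d))} (hμ : IsReinhardt μ)
    (hrep : IntegralRep S (e v) R (e (p v)) μ) :
    ∑ j, ‖S j (e v)‖ ^ 2 = c (∑ j, depthVec T v j) := by
  have h := (hμ.integralRep_iff (hS.inner_tuplePow hcomm v) _ _).1 hrep
  have hj : ∀ j, ‖S j (e v)‖ ^ 2 = c (∑ j, depthVec T v j) * ∫ z, ‖z j‖ ^ 2 ∂μ := by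
    intro j
    have hone : ∑ i, (Pi.single j 1 : Fin d → ℕ) i = 1 := by simp
    have hmon : ∀ z : EuclideanSpace ℂ (Fin d),
        ∏ i, z i ^ (Pi.single j 1 : Fin d → ℕ) i = z j := by
      intro z
      rw [Finset.prod_eq_single j]
      · simp
      · intro i _ hi
        simp [hi]
      · simp
    have := h (Pi.single j 1)
    rwa [tuplePow_single hcomm, hone, hR.norm_sq_pow_apply_e hd hfin hleaf, Finset.prod_range_one,
      add_zero, ← hp, funext fun z => congrArg (fun x : ℂ => ‖x‖ ^ 2) (hmon z)] at this
  rw [Finset.sum_congr rfl fun j _ => hj j, ← Finset.mul_sum, hμ.sum_integral_norm_sq, mul_one]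

theorem inner_Q_iterate (hd : 0 < d) (hfin : ∀ j, (T j).LocallyFinite)
    (hleaf : ∀ j, (T j).Leafless) (hS : IsMultishift T lam S)
    (hp : ∀ v, ∑ j, depthVec T v j = tensorDepth T (p v)) {c : ℕ → ℝ}
    {R : L2 (TensorVertex T) →L[ℂ] L2 (TensorVertex T)} (hR : IsBalancedShift T c R)
    (hSc : ∀ v, ∑ j, ‖S j (e v)‖ ^ 2 = c (∑ j, depthVec T v j)) (n : ℕ) (v : ∀ j, V j) :
    inner ℂ (((Q S)^[n] 1) (e v)) (e v) = ((‖(R ^ n) (e (p v))‖ ^ 2 : ℝ) : ℂ) := by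
  rw [hS.isGradedShift.Q_iterate_apply_e hSc, inner_smul_left, inner_e_left, e_apply_self,
    mul_one, Complex.conj_ofReal, hR.norm_sq_pow_apply_e hd hfin hleaf, ← hp]

/-- `Q_S^n(I)` and `(R^n)^* R^n` are diagonal operators with the same set of diagonal entries,
because every level occurs in both graphs. -/
theorem norm_Q_iterate (hd : 0 < d) (hfin : ∀ j, (T j).LocallyFinite)
    (hleaf : ∀ j, (T j).Leafless) (hS : IsMultishift T lam S)
    (hp : ∀ v, ∑ j, depthVec T v j = tensorDepth T (p v)) {c : ℕ → ℝ}
    {R : L2 (TensorVertex T) →L[ℂ] L2 (TensorVertex T)} (hR : IsBalancedShift T c R)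
    (hSc : ∀ v, ∑ j, ‖S j (e v)‖ ^ 2 = c (∑ j, depthVec T v j)) (n : ℕ) :
    ‖(Q S)^[n] 1‖ = ‖R ^ n‖ ^ 2 := by
  rw [← norm_Q_iterate_single]
  have h1 := hS.isGradedShift.Q_iterate_apply_e hSc n
  have h2 := (hR.isGradedShift hd).Q_iterate_apply_e
    (by simpa using hR.norm_sq_apply_e hd hfin hleaf) n
  refine le_antisymm (norm_le_of_diagonal h1 h2 fun v => ⟨p v, ?_⟩)
    (norm_le_of_diagonal h2 h1 fun u => ?_)
  · rw [hp]
  · obtain ⟨v, hv⟩ := exists_mem_generation T hd hleaf (tensorDepth T u)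
    have hv' : ∑ j, depthVec T v j = tensorDepth T u := hv
    exact ⟨v, by rw [hv']⟩

end Equivalence

end MultishiftTree

open MultishiftTree in
theorem mainTheorem3 {d : ℕ} (hd : 0 < d) {V : Fin d → Type*}
    (T : ∀ j, RootedDirectedTree (V j))
    (hfin : ∀ j, (T j).LocallyFinite) (hleaf : ∀ j, (T j).Leafless)
    (lam : Fin d → (∀ j, V j) → ℝ) (hlam : PositiveWeights T lam)
    (S : Fin d → L2 (∀ j, V j) →L[ℂ] L2 (∀ j, V j)) (hS : IsMultishift T lam S)
    (hinv : JointLeftInvertible S)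
    (p : (∀ j, V j) → TensorVertex T)
    (hp : ∀ v, ∑ j, depthVec T v j = tensorDepth T (p v)) :
    (SphericallyBalanced T S ↔
      ∃ (c : ℕ → ℝ) (R : L2 (TensorVertex T) →L[ℂ] L2 (TensorVertex T)),
        IsBalancedShift T c R ∧
        ∀ v, ∃ μ : Measure (EuclideanSpace ℂ (Fin d)),
          IsReinhardt μ ∧ IntegralRep S (e v) R (e (p v)) μ) ∧
    (∀ (c : ℕ → ℝ) (R : L2 (TensorVertex T) →L[ℂ] L2 (TensorVertex T))
        (μ : (∀ j, V j) → Measure (EuclideanSpace ℂ (Fin d))),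
      IsBalancedShift T c R →
      (∀ v, IsReinhardt (μ v) ∧ IntegralRep S (e v) R (e (p v)) (μ v)) →
      (∀ (v : ∀ j, V j) (a : (Fin d → ℕ) → ℂ) (f : L2 (∀ j, V j)),
        Tendsto (fun k => polySum S (e v) a k) atTop (𝓝 f) →
        ∃ F : EuclideanSpace ℂ (Fin d) → L2 (TensorVertex T),
          (∀ᵐ z ∂(μ v), Tendsto (fun k => polySumAt R (e (p v)) a k z) atTop (𝓝 (F z))) ∧
          IntegrableOn (fun z => ‖F z‖ ^ 2) (Metric.sphere 0 1) (μ v) ∧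
          ‖f‖ ^ 2 = ∫ z in Metric.sphere 0 1, ‖F z‖ ^ 2 ∂(μ v)) ∧
      (∀ (n : ℕ) (v : ∀ j, V j),
        inner ℂ (((Q S)^[n] 1) (e v)) (e v) = ((‖(R ^ n) (e (p v))‖ ^ 2 : ℝ) : ℂ)) ∧
      (∀ n : ℕ, ‖(Q S)^[n] 1‖ = ‖R ^ n‖ ^ 2)) := by

  refine ⟨⟨fun hbal => ?_, ?_⟩, ?_⟩
  · obtain ⟨c, hc, hb, hSc⟩ := hbal.exists_bounded hd hleaf hinv
    obtain ⟨R, hR⟩ := exists_isBalancedShift hd hfin hc hb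
    exact ⟨c, R, hR, exists_reinhardt_integralRep hd hfin hleaf hS hinv.1 hp hR hSc⟩
  · rintro ⟨c, R, hR, h⟩ t v hv w hw
    obtain ⟨μ, hμ, hrep⟩ := h v
    obtain ⟨μ', hμ', hrep'⟩ := h w
    have hv' : ∑ j, depthVec T v j = t := hv
    have hw' : ∑ j, depthVec T w j = t := hw
    rw [hrep.sum_norm_sq hd hfin hleaf hS hinv.1 hp hR hμ,
      hrep'.sum_norm_sq hd hfin hleaf hS hinv.1 hp hR hμ', hv', hw']
  · intro c R μ hR h
    have hSc : ∀ v, ∑ j, ‖S j (e v)‖ ^ 2 = c (∑ j, depthVec T v j) := fun v =>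
      (h v).2.sum_norm_sq hd hfin hleaf hS hinv.1 hp hR (h v).1
    exact ⟨fun v a f hf => (h v).2.exists_limit (h v).1 (hR.inner_pow hd (p v)) hf,
      inner_Q_iterate hd hfin hleaf hS hp hR hSc, norm_Q_iterate hd hfin hleaf hS hp hR hSc⟩
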